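/- Let $\Sigma=\{0,1\}$ and order $\Sigma^*$ length-first lexicographically ($\epsilon<0<1<00<01<\cdots$). For $A\subseteq\Sigma^*$ and $y\in\Sigma^*$ let $\mathrm{rank}_A(y)=|\{z\in A : z\le y\}|$. A set $A\subseteq\Sigma^*$ is \emph{semistrong-P-rankable} if there is a total function $f$ on $\Sigma^*$, computable in deterministic polynomial time, such that $f(x)=\mathrm{rank}_A(x)$ (written in binary) for every $x\in A$, and $f(x)$ is a distinguished value "not in the set" for every $x\notin A$. Let $\mathrm{P}$ be the class of subsets of $\Sigma^*$ decidable in deterministic polynomial time, $\mathrm{UP}$ the class of subsets of $\Sigma^*$ accepted by nondeterministic polynomial-time Turing machines that have at most one accepting computation path on every input, and $\mathrm{coUP}=\{A\subseteq\Sigma^* : \Sigma^*\setminus A\in\mathrm{UP}\}$. Theorem. If for every semistrong-P-rankable set $A\subseteq\Sigma^*$ the complement $\Sigma^*\setminus A$ is also semistrong-P-rankable, then $\mathrm{P}=\mathrm{UP}\cap\mathrm{coUP}$. -/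

import Mathlib

namespace RankUP

open Turing Computability

/-! Strings are lists of Booleans; `false` is the letter 0 and `true` is the letter 1. -/

/-- The length-first lexicographical order `ε, 0, 1, 00, 01, 10, 11, 000, …` on strings. -/
def StringLE (x y : List Bool) : Prop :=
  x = y ∨ List.Shortlex (· < ·) x y

/-- Only finitely many strings precede a given one, so `rank` below counts a finite set. -/
theorem finite_stringLE (y : List Bool) : {z : List Bool | StringLE z y}.Finite := by
  refine (List.finite_length_le Bool y.length).subset ?_
  rintro z (rfl | h)
  · exact le_refl z.length
  · rcases List.shortlex_def.1 h with h | h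
    · exact h.le
    · exact h.1.le

/-- `rank A y` is the number of elements of `A` that are at most `y`. -/
noncomputable def rank (A : Set (List Bool)) (y : List Bool) : ℕ :=
  {z : List Bool | StringLE z y ∧ z ∈ A}.ncard

/-- Total functions from strings to strings computed by a deterministic Turing machine in time
polynomial in the length of the input. -/
def FP : Set (List Bool → List Bool) :=
  {f | Nonempty (TM2ComputableInPolyTime
    (id : List Bool → List Bool) (id : List Bool → List Bool) f)}

/-- Outputs of semistrong ranking functions as strings: `[false]` means "not in the set", and
`true` followed by the binary numeral of `n` is the rank `n`. -/
def encodeRank : Option ℕ → List Bool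
  | none => [false]
  | some n => true :: encodeNat n

/-- `f` is a semistrong ranking function for `A`: it returns the rank on elements of `A` and says
"not in the set" on all other strings. -/
def IsSemistrongRankingFunction (A : Set (List Bool)) (f : List Bool → List Bool) : Prop :=
  (∀ x ∈ A, f x = encodeRank (some (rank A x))) ∧ (∀ x ∉ A, f x = encodeRank none)

/-- The class of semistrong-`F`-rankable sets. -/
def SemistrongRankable (F : Set (List Bool → List Bool)) : Set (Set (List Bool)) :=
  {A | ∃ f ∈ F, IsSemistrongRankingFunction A f}

/-- A class of sets of strings is closed under complementation. -/
def ClosedUnderCompl (C : Set (Set (List Bool))) : Prop :=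
  ∀ A ∈ C, Aᶜ ∈ C

open Classical in
/-- The class P: the sets whose characteristic function is computed by a deterministic
Turing machine in polynomial time. -/
def classP : Set (Set (List Bool)) :=
  {A | Nonempty (TM2ComputableInPolyTime
    (id : List Bool → List Bool) encodeBool (fun x => decide (x ∈ A)))}

/-- A nondeterministic Turing machine with input alphabet `{0,1}`. It is the nondeterministic
version of Mathlib's `Turing.FinTM2`: finitely many stacks, labels and internal states, and each
label carries a finite list of alternative statements. As there are finitely many statements,
each pushing one of finitely many symbols, only finitely many stack symbols ever occur. -/
structure NTM where
  /-- index type of the stacks -/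
  K : Type
  [decEqK : DecidableEq K]
  [finK : Fintype K]
  /-- the input stack -/
  k₀ : K
  /-- symbols of each stack -/
  Γ : K → Type
  /-- the input stack holds bits -/
  inputAlphabet : Γ k₀ ≃ Bool
  /-- labels of the program -/
  Λ : Type
  [finΛ : Fintype Λ]
  /-- the label at which the computation starts -/
  main : Λ
  /-- internal states -/
  σ : Type
  [finσ : Fintype σ]
  /-- the internal state at the start -/
  initialState : σ
  /-- the internal states in which halting means acceptance -/
  accept : Set σ
  /-- the alternatives at each label; the machine executes any one of them in one step -/
  m : Λ → List (TM2.Stmt Γ Λ σ)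

namespace NTM

variable (M : NTM)

/-- Configurations. The label is `none` exactly when the machine has halted. -/
abbrev Cfg : Type := TM2.Cfg M.Γ M.Λ M.σ

/-- The initial configuration on input `x`: all stacks other than the input stack are empty. -/
def init (x : List Bool) : M.Cfg where
  l := some M.main
  var := M.initialState
  stk := letI := M.decEqK
    Function.update (fun _ => []) M.k₀ (x.map M.inputAlphabet.symm)

/-- One step in which the machine takes alternative number `i`; `none` if it has halted or has no
such alternative. -/
def step (c : M.Cfg) (i : ℕ) : Option M.Cfg :=
  letI := M.decEqK
  c.l.bind fun l => (M.m l)[i]?.map fun q => TM2.stepAux q c.var c.stk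

/-- The configuration reached on input `x` after the successive choices in `w`; `none` if `w` is
not a sequence of choices available to the machine. -/
def run (x : List Bool) (w : List ℕ) : Option M.Cfg :=
  w.foldlM M.step (M.init x)

/-- `w` is an accepting path on input `x`: it leads to a halting configuration whose internal
state is accepting. -/
def IsAcceptingPath (x : List Bool) (w : List ℕ) : Prop :=
  ∃ c, M.run x w = some c ∧ c.l = none ∧ c.var ∈ M.accept

/-- Every computation path, accepting or not, has length bounded by a polynomial in the length of
the input. -/
def PolyTime : Prop :=
  ∃ p : Polynomial ℕ, ∀ (x : List Bool) (w : List ℕ),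
    (M.run x w).isSome → w.length ≤ p.eval x.length

/-- No input has two distinct accepting paths. -/
def Unambiguous : Prop :=
  ∀ (x : List Bool) (w w' : List ℕ),
    M.IsAcceptingPath x w → M.IsAcceptingPath x w' → w = w'

/-- The set of inputs that have an accepting path. -/
def language : Set (List Bool) :=
  {x | ∃ w, M.IsAcceptingPath x w}

end NTM

/-- The class UP: the sets accepted by unambiguous nondeterministic polynomial-time machines. -/
def classUP : Set (Set (List Bool)) :=
  {A | ∃ M : NTM, M.PolyTime ∧ M.Unambiguous ∧ M.language = A}

/-- The class coUP: the sets whose complement is in UP. -/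
def classCoUP : Set (Set (List Bool)) :=
  {A | Aᶜ ∈ classUP}

end RankUP

/-! P lies in UP ∩ coUP because a deterministic machine is a nondeterministic one with a single
alternative per label (`mem_classUP_of_mem_classP`).

For the converse let A be in UP ∩ coUP, with unambiguous machines for A (bit b = 1) and for its
complement (b = 0). Accepting paths are written as bit strings z padded to length Z = c(|x|+1)^k.
For every x there is exactly one pair (b, z) such that z is a witness for x and machine b, and b = 1
iff x ∈ A. Let B be the set of the strings Y(x) = code(x) b z, where the code is self-delimiting and
its length depends only on |x|. Then Y is strictly increasing, so the rank of Y(x) in B is the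
position of x among all strings, whose binary numeral is 1x. Hence B is semistrong-rankable: verify
the witness and output 1x (`exists_ranker`).

By hypothesis the complement of B has a ranking function g. It is applied to q = code(x) 0 1^Z, the
greatest string of its length that starts with code(x) 0. So Y(x) ≤ q iff x ∉ A, and every other
Y(x') is on the side of q given by the order of x and x'. The rank of q in B is therefore the
position of x if x ∉ A, and one less if x ∈ A (`rank_range`). If q ∈ B, then x ∉ A. Otherwise g
returns the rank of q in the complement; the two ranks add up to the position of q, which is odd
because q ends in 1. Thus x ∈ A iff the returned rank and the position of x have the same parity,
and it suffices to compare two bits (`answer`, `mem_classP_of_mem`).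

Time bounds are proved for structured programs, in which only passages through loop heads count.
`Exec.reachIn` compiles them to `TM2` machines; `nonempty_polyTime_of_runs` and
`mem_classUP_of_runs` turn the bounds into membership in the classes. -/

namespace RankUP

open Turing Computability

/-! ### Structured stack programs and their compilation to `TM2` statements -/

section Programs

variable {K : Type} {Γ : K → Type} {σ : Type}

/-- Structured programs over stacks `Γ` and a register of type `σ`. The loop `loop p f q` runs
`p`, leaves if the test `f` fails, and otherwise runs `q` and starts again. -/
inductive Prog {K : Type} (Γ : K → Type) (σ : Type) : Type
  | skip : Prog Γ σ
  | push (k : K) (f : σ → Γ k) : Prog Γ σ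
  | peek (k : K) (f : σ → Option (Γ k) → σ) : Prog Γ σ
  | pop (k : K) (f : σ → Option (Γ k) → σ) : Prog Γ σ
  | load (f : σ → σ) : Prog Γ σ
  | seq (p q : Prog Γ σ) : Prog Γ σ
  | ite (f : σ → Bool) (p q : Prog Γ σ) : Prog Γ σ
  | loop (p : Prog Γ σ) (f : σ → Bool) (q : Prog Γ σ) : Prog Γ σ

/-- The memory of a structured program. -/
@[ext]
structure State {K : Type} (Γ : K → Type) (σ : Type) where
  /-- the register -/
  var : σ
  /-- the stacks -/
  stk : ∀ k, List (Γ k)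

/-- Big-step semantics; only the passages through the head of a loop are counted. -/
inductive Exec [DecidableEq K] : Prog Γ σ → State Γ σ → ℕ → State Γ σ → Prop
  | skip (s) : Exec .skip s 0 s
  | push (k f s) : Exec (.push k f) s 0 ⟨s.var, Function.update s.stk k (f s.var :: s.stk k)⟩
  | peek (k f s) : Exec (.peek k f) s 0 ⟨f s.var (s.stk k).head?, s.stk⟩
  | pop (k f s) : Exec (.pop k f) s 0
      ⟨f s.var (s.stk k).head?, Function.update s.stk k (s.stk k).tail⟩
  | load (f s) : Exec (.load f) s 0 ⟨f s.var, s.stk⟩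
  | seq {p q s t s' t' s''} : Exec p s t s' → Exec q s' t' s'' → Exec (.seq p q) s (t + t') s''
  | iteTrue {f p q s t s'} : f s.var = true → Exec p s t s' → Exec (.ite f p q) s t s'
  | iteFalse {f p q s t s'} : f s.var = false → Exec q s t s' → Exec (.ite f p q) s t s'
  | loopExit {p f q s t s'} : Exec p s t s' → f s'.var = false → Exec (.loop p f q) s (1 + t) s'
  | loopNext {p f q s t s' t' s'' t'' s'''} : Exec p s t s' → f s'.var = true →
      Exec q s' t' s'' → Exec (.loop p f q) s'' t'' s''' →
      Exec (.loop p f q) s (1 + t + t' + t'') s'''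

namespace Prog

/-- The labels needed to compile a program: one for each loop. -/
def Lab : Prog Γ σ → Type
  | skip | push _ _ | peek _ _ | pop _ _ | load _ => Empty
  | seq p q | ite _ p q => Lab p ⊕ Lab q
  | loop p _ q => Option (Lab p ⊕ Lab q)

instance finite_lab : ∀ p : Prog Γ σ, Finite p.Lab
  | skip | push _ _ | peek _ _ | pop _ _ | load _ => inferInstanceAs (Finite Empty)
  | seq p q | ite _ p q =>
    have := finite_lab p
    have := finite_lab q
    inferInstanceAs (Finite (Lab p ⊕ Lab q))
  | loop p _ q =>
    have := finite_lab p
    have := finite_lab q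
    inferInstanceAs (Finite (Option (Lab p ⊕ Lab q)))

variable {Λ : Type}

/-- The statement that starts the program `p` and goes on with `c`. -/
def entry : (p : Prog Γ σ) → (p.Lab → Λ) → TM2.Stmt Γ Λ σ → TM2.Stmt Γ Λ σ
  | skip, _, c => c
  | push k f, _, c => .push k f c
  | peek k f, _, c => .peek k f c
  | pop k f, _, c => .pop k f c
  | load f, _, c => .load f c
  | seq p q, e, c => p.entry (e ∘ Sum.inl) (q.entry (e ∘ Sum.inr) c)
  | ite f p q, e, c => .branch f (p.entry (e ∘ Sum.inl) c) (q.entry (e ∘ Sum.inr) c)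
  -- The continuation of a loop occurs only behind the exit test, in the code at the label of the
  -- loop.
  | loop _ _ _, e, _ => .goto fun _ => e none

/-- The statements at the labels of the program `p` when it goes on with `c`. -/
def code : (p : Prog Γ σ) → (p.Lab → Λ) → TM2.Stmt Γ Λ σ → p.Lab → TM2.Stmt Γ Λ σ
  | skip, _, _ | push _ _, _, _ | peek _ _, _, _ | pop _ _, _, _ | load _, _, _ => Empty.elim
  | seq p q, e, c =>
    Sum.elim (p.code (e ∘ Sum.inl) (q.entry (e ∘ Sum.inr) c)) (q.code (e ∘ Sum.inr) c)
  | ite _ p q, e, c => Sum.elim (p.code (e ∘ Sum.inl) c) (q.code (e ∘ Sum.inr) c)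
  | loop p f q, e, c =>
    let back : TM2.Stmt Γ Λ σ := .goto fun _ => e none
    let test : TM2.Stmt Γ Λ σ := .branch f (q.entry (e ∘ some ∘ Sum.inr) back) c
    fun l => l.elim (p.entry (e ∘ some ∘ Sum.inl) test)
      (Sum.elim (p.code (e ∘ some ∘ Sum.inl) test) (q.code (e ∘ some ∘ Sum.inr) back))

/-- An upper bound for the number of symbols pushed between two passages through loop heads. -/
def weight : Prog Γ σ → ℕ
  | push _ _ => 1
  | skip | peek _ _ | pop _ _ | load _ => 0
  | seq p q | ite _ p q | loop p _ q => p.weight + q.weight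

end Prog

variable [DecidableEq K]

/-- `b` is reached from `a` in exactly `t` steps. -/
def ReachIn {Λ : Type} (M : Λ → TM2.Stmt Γ Λ σ) (t : ℕ) (a b : TM2.Cfg Γ Λ σ) : Prop :=
  (flip bind (TM2.step M))^[t] (some a) = some b

theorem ReachIn.refl {Λ : Type} {M : Λ → TM2.Stmt Γ Λ σ} (a : TM2.Cfg Γ Λ σ) :
    ReachIn M 0 a a := rfl

theorem ReachIn.trans {Λ : Type} {M : Λ → TM2.Stmt Γ Λ σ} {s t : ℕ} {a b c : TM2.Cfg Γ Λ σ}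
    (h : ReachIn M s a b) (h' : ReachIn M t b c) : ReachIn M (s + t) a c := by
  unfold ReachIn at *
  rw [add_comm, Function.iterate_add_apply, h, h']

theorem ReachIn.single {Λ : Type} {M : Λ → TM2.Stmt Γ Λ σ} {a b : TM2.Cfg Γ Λ σ}
    (h : TM2.step M a = some b) : ReachIn M 1 a b := h

/-- `TM2` executes all code up to the next jump in a single step, and compiled code jumps only to
loop heads. So the count in `Exec` is exactly the number of machine steps. -/
theorem Exec.reachIn {p : Prog Γ σ} {s s' : State Γ σ} {t : ℕ} (h : Exec p s t s') {Λ : Type}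
    (M : Λ → TM2.Stmt Γ Λ σ) (e : p.Lab → Λ) (c : TM2.Stmt Γ Λ σ)
    (hM : ∀ l, M (e l) = p.code e c l) :
    ReachIn M t (TM2.stepAux (p.entry e c) s.var s.stk) (TM2.stepAux c s'.var s'.stk) := by
  induction h generalizing c with
  | skip | push | peek | pop | load => exact ReachIn.refl _
  | seq _ _ ih ih' =>
    exact (ih _ _ fun l => hM (.inl l)).trans (ih' _ _ fun l => hM (.inr l))
  | iteTrue hf _ ih =>
    simp only [Prog.entry, TM2.stepAux, hf, cond_true]
    exact ih _ _ fun l => hM (.inl l)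
  | iteFalse hf _ ih =>
    simp only [Prog.entry, TM2.stepAux, hf, cond_false]
    exact ih _ _ fun l => hM (.inr l)
  | @loopExit p f q s t s' _ hf ih =>
    refine (ReachIn.single rfl).trans ?_
    rw [hM none]
    have h := ih (e ∘ some ∘ Sum.inl) _ fun l => hM (some (.inl l))
    simp only [TM2.stepAux, hf, cond_false] at h
    exact h
  | loopNext _ hf _ _ ih ih' ih'' =>
    rw [add_assoc, add_assoc]
    refine (ReachIn.single rfl).trans ?_
    rw [hM none]
    refine (ih (e ∘ some ∘ Sum.inl) _ fun l => hM (some (.inl l))).trans ?_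
    simp only [TM2.stepAux, hf, cond_true]
    exact (ih' (e ∘ some ∘ Sum.inr) _ fun l => hM (some (.inr l))).trans (ih'' e c hM)

/-- A running time bounds what is left on the stacks, hence the cost of clearing them at the end. -/
theorem Exec.length_le {p : Prog Γ σ} {s s' : State Γ σ} {t : ℕ} (h : Exec p s t s') (k : K) :
    (s'.stk k).length ≤ (s.stk k).length + p.weight * (t + 1) := by
  induction h with
  | skip | peek | load => simp
  | push k' f s =>
    by_cases hk : k = k'
    · subst hk; simp [Prog.weight]
    · simp [Function.update_of_ne hk]
  | pop k' f s =>
    by_cases hk : k = k'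
    · subst hk; simp; omega
    · simp [Function.update_of_ne hk]
  | seq _ _ ih ih' => simp only [Prog.weight]; nlinarith
  | iteTrue _ _ ih | iteFalse _ _ ih => simp only [Prog.weight]; nlinarith
  | loopExit _ hf ih => simp only [Prog.weight]; nlinarith
  | loopNext _ hf _ _ ih ih' ih'' => simp only [Prog.weight] at *; nlinarith

/-- From `s`, the program `p` ends after at most `T` passages through loop heads, in a state
satisfying `Q`. -/
def Runs (p : Prog Γ σ) (s : State Γ σ) (T : ℕ) (Q : State Γ σ → Prop) : Prop :=
  ∃ t ≤ T, ∃ s', Exec p s t s' ∧ Q s'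

namespace Runs

variable {p q : Prog Γ σ} {s : State Γ σ} {T T' : ℕ} {Q Q' : State Γ σ → Prop}

theorem mono (h : Runs p s T Q) (hT : T ≤ T') (hQ : ∀ s', Q s' → Q' s') : Runs p s T' Q' := by
  obtain ⟨t, ht, s', h, h'⟩ := h
  exact ⟨t, ht.trans hT, s', h, hQ _ h'⟩

theorem le (h : Runs p s T Q) (hT : T ≤ T') : Runs p s T' Q := h.mono hT fun _ h => h

theorem skip (h : Q s) : Runs .skip s T Q := ⟨0, zero_le, _, .skip _, h⟩

theorem push {k f} (h : Q ⟨s.var, Function.update s.stk k (f s.var :: s.stk k)⟩) :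
    Runs (.push k f) s T Q := ⟨0, zero_le, _, .push .., h⟩

theorem peek {k f} (h : Q ⟨f s.var (s.stk k).head?, s.stk⟩) :
    Runs (.peek k f) s T Q := ⟨0, zero_le, _, .peek .., h⟩

theorem pop {k f} (h : Q ⟨f s.var (s.stk k).head?, Function.update s.stk k (s.stk k).tail⟩) :
    Runs (.pop k f) s T Q := ⟨0, zero_le, _, .pop .., h⟩

theorem load {f} (h : Q ⟨f s.var, s.stk⟩) : Runs (.load f) s T Q := ⟨0, zero_le, _, .load .., h⟩

theorem seq (h : Runs p s T fun s' => Runs q s' T' Q) : Runs (.seq p q) s (T + T') Q := by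
  obtain ⟨t, ht, s', h, t', ht', s'', h', hQ⟩ := h
  exact ⟨_, add_le_add ht ht', _, h.seq h', hQ⟩

/-- Sequencing when the first program does not use loops. -/
theorem seq_zero (h : Runs p s 0 fun s' => Runs q s' T Q) : Runs (.seq p q) s T Q :=
  (seq h).mono (by simp) fun _ h => h

theorem ite {f} (h : f s.var = true → Runs p s T Q) (h' : f s.var = false → Runs q s T Q) :
    Runs (.ite f p q) s T Q := by
  cases hf : f s.var
  · obtain ⟨t, ht, s', h, hQ⟩ := h' hf
    exact ⟨t, ht, s', .iteFalse hf h, hQ⟩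
  · obtain ⟨t, ht, s', h, hQ⟩ := h hf
    exact ⟨t, ht, s', .iteTrue hf h, hQ⟩

theorem loopExit {f} (h : Runs p s T fun s' => f s'.var = false ∧ Q s') :
    Runs (.loop p f q) s (1 + T) Q := by
  obtain ⟨t, ht, s', h, hf, hQ⟩ := h
  exact ⟨_, by omega, _, .loopExit h hf, hQ⟩

theorem loopNext {f T''} (h : Runs p s T fun s' => f s'.var = true ∧
    Runs q s' T' fun s'' => Runs (.loop p f q) s'' T'' Q) :
    Runs (.loop p f q) s (1 + T + T' + T'') Q := by
  obtain ⟨t, ht, s', h, hf, t', ht', s'', h', t'', ht'', s''', h'', hQ⟩ := h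
  exact ⟨_, by omega, _, .loopNext h hf h' h'', hQ⟩

end Runs

/-- Pop the symbols of stack `k` one after the other, and run `p` after each. -/
def Prog.forEach (k : K) (f : σ → Option (Γ k) → σ) (c : σ → Bool) (p : Prog Γ σ) : Prog Γ σ :=
  .loop (.pop k f) c p

/-- The loop rule: the invariant is indexed by the symbols still on the stack, and `hc` makes the
test recognise the empty stack. The last summand is the passage that finds the stack empty. -/
theorem Runs.forEach {k : K} {f : σ → Option (Γ k) → σ} {c : σ → Bool} {p : Prog Γ σ} {T : ℕ}
    {Q : State Γ σ → Prop} (hc : ∀ v o, c (f v o) = o.isSome) (I : List (Γ k) → State Γ σ → Prop)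
    (hI : ∀ l s, I l s → s.stk k = l)
    (hstep : ∀ a l s, I (a :: l) s →
      Runs p ⟨f s.var (some a), Function.update s.stk k l⟩ T (I l))
    (hend : ∀ s, I [] s → Q ⟨f s.var none, s.stk⟩) {l : List (Γ k)} {s : State Γ σ} (h : I l s) :
    Runs (.forEach k f c p) s (l.length * (T + 1) + 1) Q := by
  induction l generalizing s with
  | nil =>
    have hk := hI _ _ h
    refine (Runs.loopExit (T := 0) (Runs.pop ?_)).mono (by simp) fun _ h => h
    refine ⟨by simp [hc, hk], ?_⟩
    have : Function.update s.stk k (s.stk k).tail = s.stk := by simp [hk]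
    rw [this, hk]
    exact hend _ h
  | cons a l ih =>
    have hk := hI _ _ h
    refine (Runs.loopNext (T := 0) (T' := T) (T'' := l.length * (T + 1) + 1)
      (Runs.pop ?_)).mono ?_ fun _ h => h
    · refine ⟨by simp [hc, hk], ?_⟩
      simp only [hk, List.head?_cons, List.tail_cons]
      exact (hstep _ _ _ h).mono le_rfl fun _ h => ih h
    · simp only [List.length_cons]; nlinarith

end Programs

/-! ### From structured programs to polynomial-time machines and to UP -/

section Machines

variable {K : Type} [DecidableEq K] {Γ : K → Type} {σ : Type}

theorem Runs.with_length {p : Prog Γ σ} {s : State Γ σ} {T : ℕ} {Q : State Γ σ → Prop}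
    (h : Runs p s T Q) :
    Runs p s T fun s' => Q s' ∧ ∀ k, (s'.stk k).length ≤ (s.stk k).length + p.weight * (T + 1) := by
  obtain ⟨t, ht, s', h, hQ⟩ := h
  refine ⟨t, ht, s', h, hQ, fun k => (h.length_le k).trans ?_⟩
  gcongr

/-- Empty the stack `k`. -/
def Prog.clear (put : σ → Bool → σ) (flag : σ → Bool) (k : K) : Prog Γ σ :=
  .forEach k (fun v o => put v o.isSome) flag .skip

theorem Runs.clear {put : σ → Bool → σ} {flag : σ → Bool} (hflag : ∀ v b, flag (put v b) = b)
    (k : K) (s : State Γ σ) :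
    Runs (.clear put flag k) s ((s.stk k).length + 1)
      fun s' => s'.stk = Function.update s.stk k [] := by
  refine (Runs.forEach (T := 0) (l := s.stk k) (fun v o => hflag v _)
    (fun l s' => s'.stk = Function.update s.stk k l) ?_ ?_ ?_ ?_).mono (by simp) fun _ h => h
  · intro l s' h; simp [h]
  · intro a l s' h
    exact Runs.skip (by simp [h])
  · intro s' h; exact h
  · simp

/-- Empty all stacks in a list. -/
def Prog.clearAll (put : σ → Bool → σ) (flag : σ → Bool) : List K → Prog Γ σ
  | [] => .skip
  | k :: l => .seq (.clear put flag k) (clearAll put flag l)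

theorem Runs.clearAll {put : σ → Bool → σ} {flag : σ → Bool} (hflag : ∀ v b, flag (put v b) = b)
    (N : ℕ) (l : List K) (s : State Γ σ) (hs : ∀ k, (s.stk k).length ≤ N) :
    Runs (.clearAll put flag l) s (l.length * (N + 1))
      fun s' => (∀ k ∈ l, s'.stk k = []) ∧ ∀ k ∉ l, s'.stk k = s.stk k := by
  induction l generalizing s with
  | nil => exact Runs.skip (by simp)
  | cons k l ih =>
    refine (Runs.seq ((Runs.clear hflag k s).mono (T' := N + 1) (by simpa using hs k)
      (fun s' hs' => (ih s' ?_).mono le_rfl ?_))).mono ?_ fun _ h => h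
    · intro k'
      by_cases hk : k' = k
      · subst hk; simp [hs']
      · simpa [hs', hk] using hs k'
    · rintro s'' ⟨h₁, h₂⟩
      refine ⟨?_, ?_⟩
      · intro k' hk'
        by_cases h : k' ∈ l
        · exact h₁ _ h
        · obtain rfl : k' = k := by simpa [h] using hk'
          simp [h₂ _ h, hs']
      · intro k' hk'
        simp only [List.mem_cons, not_or] at hk'
        simp [h₂ _ hk'.2, hs', hk'.1]
    · simp only [List.length_cons]; nlinarith

/-- The initial memory: the input `l` on stack `k`, and nothing elsewhere. -/
def State.ofInput (v : σ) (k : K) (l : List (Γ k)) : State Γ σ :=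
  ⟨v, Function.update (fun _ => []) k l⟩

/-- The machine that runs a structured program and halts. -/
def Prog.machine (p : Prog Γ σ) : Option p.Lab → TM2.Stmt Γ (Option p.Lab) σ
  | none => p.entry some .halt
  | some l => p.code some .halt l

theorem Exec.reachIn_machine {p : Prog Γ σ} {s s' : State Γ σ} {t : ℕ} (h : Exec p s t s') :
    ReachIn p.machine (1 + t) ⟨some none, s.var, s.stk⟩ ⟨none, s'.var, s'.stk⟩ :=
  (ReachIn.single rfl).trans (h.reachIn p.machine some .halt fun _ => rfl)

/-- The definition transports the list along an equality of stack indices; `Function.update` avoids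
the cast. -/
theorem initList_eq (tm : FinTM2) (l : List (tm.Γ tm.k₀)) :
    initList tm l = ⟨some tm.main, tm.initialState, Function.update (fun _ => []) tm.k₀ l⟩ := by
  unfold initList
  congr 1
  funext k
  by_cases hk : k = tm.k₀
  · subst hk
    simp
  · simp [hk]

theorem haltList_eq (tm : FinTM2) (l : List (tm.Γ tm.k₁)) :
    haltList tm l = ⟨none, tm.initialState, Function.update (fun _ => []) tm.k₁ l⟩ := by
  unfold haltList
  congr 1
  funext k
  by_cases hk : k = tm.k₁
  · subst hk
    simp
  · simp [hk]

open Polynomial in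
/-- A function is computable in polynomial time if some structured program leaves its value on
the stack `k₁` after a polynomial number of passages through loop heads. -/
theorem nonempty_polyTime_of_runs [Finite K] [Finite σ] {β : Type} {enc : β → List Bool}
    {f : List Bool → β} (k₀ k₁ : K) (e₀ : Γ k₀ ≃ Bool) (e₁ : Γ k₁ ≃ Bool) (v₀ : σ)
    (put : σ → Bool → σ) (flag : σ → Bool) (hflag : ∀ v b, flag (put v b) = b) (p : Prog Γ σ)
    (P : ℕ[X])
    (h : ∀ x, Runs p (.ofInput v₀ k₀ (x.map e₀.symm)) (P.eval x.length)
      fun s => s.stk k₁ = (enc (f x)).map e₁.symm) :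
    Nonempty (TM2ComputableInPolyTime (id : List Bool → List Bool) enc f) := by
  have : Fintype K := Fintype.ofFinite K
  have : Fintype σ := Fintype.ofFinite σ
  have : Fintype (Γ k₀) := Fintype.ofEquiv Bool e₀.symm
  -- A computation has to end with the output stack alone nonempty and with the initial internal
  -- state, so all other stacks are cleared and the register is reset.
  let L : List K := Finset.univ.toList.filter (· ≠ k₁)
  let r : Prog Γ σ := .seq p (.seq (.clearAll put flag L) (.load fun _ => v₀))
  have : Fintype r.Lab := Fintype.ofFinite _
  let tm : FinTM2 :=
    { K := K, k₀ := k₀, k₁ := k₁, Γ := Γ, Λ := Option r.Lab, main := none, σ := σ,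
      initialState := v₀, m := r.machine }
  -- The time of `p`, and for each cleared stack a loop over at most the input length plus the
  -- symbols that `p` can push.
  let B : ℕ[X] := P + C L.length * (X + C p.weight * (P + 1) + 1)
  have hr : ∀ x, Runs r (.ofInput v₀ k₀ (x.map e₀.symm)) (B.eval x.length) fun s =>
      s = .ofInput v₀ k₁ ((enc (f x)).map e₁.symm) := by
    intro x
    refine ((h x).with_length.mono (T' := P.eval x.length) le_rfl fun s hs => ?_).seq.mono
      (T := _ + L.length * (x.length + p.weight * (P.eval x.length + 1) + 1)) (by simp [B])
      fun _ h => h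
    obtain ⟨hs, hl⟩ := hs
    refine ((Runs.clearAll hflag _ L s fun k => (hl k).trans ?_).mono le_rfl
      fun s' hs' => Runs.load (T := 0) ?_).seq
    · gcongr
      by_cases hk : k = k₀
      · subst hk; simp [State.ofInput]
      · simp [State.ofInput, hk]
    · refine State.ext rfl (funext fun k => ?_)
      by_cases hk : k = k₁
      · subst hk
        simp [State.ofInput, hs'.2 k (by simp [L]), hs]
      · simp [State.ofInput, hk, hs'.1 k (by simp [L, hk])]
  have hinit : ∀ l, initList tm l = ⟨some none, v₀, (State.ofInput v₀ k₀ l).stk⟩ := by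
    intro l
    exact initList_eq tm l
  have hhalt : ∀ l, haltList tm l = ⟨none, v₀, (State.ofInput v₀ k₁ l).stk⟩ := by
    intro l
    exact haltList_eq tm l
  choose t ht s hs hQ using hr
  refine ⟨{ tm := tm, inputAlphabet := e₀, outputAlphabet := e₁, time := 1 + B,
            outputsFun := fun x => ⟨⟨1 + t x, ?_⟩, ?_⟩ }⟩
  · have := (hs x).reachIn_machine
    rw [hQ] at this
    simp only [Option.map_some, id]
    erw [hinit, hhalt]
    exact this
  · simpa using ht x

section Deterministic

variable {Λ : Type} {M : Λ → TM2.Stmt Γ Λ σ}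

theorem reachIn_succ {t : ℕ} {a c : TM2.Cfg Γ Λ σ} :
    ReachIn M (t + 1) a c ↔ ∃ b, TM2.step M a = some b ∧ ReachIn M t b c := by
  have hnone : ∀ t, (flip bind (TM2.step M))^[t] none = none := fun t => by
    induction t with
    | zero => rfl
    | succ t ih => rw [Function.iterate_succ_apply]; exact ih
  unfold ReachIn
  rw [Function.iterate_succ_apply]
  change (flip bind (TM2.step M))^[t] (TM2.step M a) = _ ↔ _
  cases h : TM2.step M a with
  | none => simpa using fun h => Option.some_ne_none c (h.symm.trans (hnone t))
  | some b => simp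

theorem step_eq_none {a : TM2.Cfg Γ Λ σ} (h : a.l = none) : TM2.step M a = none := by
  obtain ⟨l, v, S⟩ := a
  obtain rfl : l = none := h
  rfl

/-- When 0 is the only available choice, paths are initial segments of the deterministic
computation, and a halting path is all of it. -/
theorem foldlM_eq_some {f : TM2.Cfg Γ Λ σ → ℕ → Option (TM2.Cfg Γ Λ σ)}
    (hf : ∀ a i, f a i = if i = 0 then TM2.step M a else none) {t : ℕ} {a c : TM2.Cfg Γ Λ σ}
    (h : ReachIn M t a c) (hc : c.l = none) {w : List ℕ} {d : TM2.Cfg Γ Λ σ}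
    (hd : w.foldlM f a = some d) :
    w.length ≤ t ∧ w = List.replicate w.length 0 ∧ (d.l = none → w.length = t ∧ d = c) := by
  induction t generalizing a w with
  | zero =>
    obtain rfl : a = c := by simpa [ReachIn] using h
    cases w with
    | nil =>
      obtain rfl : a = d := by simpa using hd
      simp
    | cons i w => simp [hf, step_eq_none hc] at hd
  | succ t ih =>
    obtain ⟨b, hb, h⟩ := reachIn_succ.1 h
    cases w with
    | nil =>
      obtain rfl : a = d := by simpa using hd
      refine ⟨by simp, rfl, fun ha => ?_⟩
      rw [step_eq_none ha] at hb
      cases hb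
    | cons i w =>
      by_cases hi : i = 0
      · subst hi
        simp only [List.foldlM_cons, hf, if_true, hb] at hd
        obtain ⟨h₁, h₂, h₃⟩ := ih h hd
        refine ⟨by simpa using h₁, ?_, fun hd => ?_⟩
        · simpa [List.replicate_succ] using h₂
        · simpa using h₃ hd
      · simp [hf, hi] at hd

theorem foldlM_replicate {f : TM2.Cfg Γ Λ σ → ℕ → Option (TM2.Cfg Γ Λ σ)}
    (hf : ∀ a i, f a i = if i = 0 then TM2.step M a else none) {t : ℕ} {a c : TM2.Cfg Γ Λ σ}
    (h : ReachIn M t a c) : (List.replicate t 0).foldlM f a = some c := by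
  induction t generalizing a with
  | zero => simpa [ReachIn] using h
  | succ t ih =>
    obtain ⟨b, hb, h⟩ := reachIn_succ.1 h
    simp only [List.replicate_succ, List.foldlM_cons, hf, if_true, hb]
    exact ih h

end Deterministic

/-- The nondeterministic machine with only one alternative at each label. -/
def deterministicNTM [Fintype K] [Fintype σ] {Λ : Type} [Fintype Λ] (M : Λ → TM2.Stmt Γ Λ σ)
    (k₀ : K) (e₀ : Γ k₀ ≃ Bool) (main : Λ) (v₀ : σ) (acc : Set σ) : NTM :=
  { K := K, k₀ := k₀, Γ := Γ, inputAlphabet := e₀, Λ := Λ, main := main, σ := σ,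
    initialState := v₀, accept := acc, m := fun l => [M l] }

section

variable [Fintype K] [Fintype σ] {Λ : Type} [Fintype Λ] {M : Λ → TM2.Stmt Γ Λ σ}
    {k₀ : K} {e₀ : Γ k₀ ≃ Bool} {main : Λ} {v₀ : σ} {acc : Set σ}

theorem deterministicNTM_step (a : TM2.Cfg Γ Λ σ) (i : ℕ) :
    (deterministicNTM M k₀ e₀ main v₀ acc).step a i = if i = 0 then TM2.step M a else none := by
  obtain ⟨l, v, S⟩ := a
  cases l with
  | none => exact (ite_self _).symm
  | some l => cases i <;> rfl

end

/-- A set is in UP if some structured program decides it in polynomial time. -/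
theorem mem_classUP_of_runs [Finite K] [Finite σ] {A : Set (List Bool)} (k₀ : K)
    (e₀ : Γ k₀ ≃ Bool) (v₀ : σ) (acc : Set σ) (p : Prog Γ σ) (P : Polynomial ℕ)
    (h : ∀ x, Runs p (.ofInput v₀ k₀ (x.map e₀.symm)) (P.eval x.length)
      fun s => s.var ∈ acc ↔ x ∈ A) : A ∈ classUP := by
  have : Fintype K := Fintype.ofFinite K
  have : Fintype σ := Fintype.ofFinite σ
  have : Fintype p.Lab := Fintype.ofFinite _
  let N := deterministicNTM p.machine k₀ e₀ none v₀ acc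
  choose t ht s hs hQ using h
  have key : ∀ x, ReachIn p.machine (1 + t x) (N.init x) ⟨none, (s x).var, (s x).stk⟩ :=
    fun x => (hs x).reachIn_machine
  -- The path of `1 + t x` zeros is the only candidate, which gives unambiguity and the language at
  -- once.
  have acc_iff : ∀ x w, N.IsAcceptingPath x w ↔ w = List.replicate (1 + t x) 0 ∧ x ∈ A := by
    intro x w
    constructor
    · rintro ⟨c, hc, hl, hv⟩
      obtain ⟨-, h₂, h₃⟩ := foldlM_eq_some deterministicNTM_step (key x) rfl hc
      obtain ⟨h₄, rfl⟩ := h₃ hl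
      exact ⟨h₄ ▸ h₂, (hQ x).1 hv⟩
    · rintro ⟨rfl, hx⟩
      exact ⟨_, foldlM_replicate deterministicNTM_step (key x), rfl, (hQ x).2 hx⟩
  refine ⟨N, ⟨1 + P, fun x w hw => ?_⟩, fun x w w' hw hw' => ?_, ?_⟩
  · obtain ⟨d, hd⟩ := Option.isSome_iff_exists.1 hw
    refine (foldlM_eq_some deterministicNTM_step (key x) rfl hd).1.trans ?_
    simpa using ht x
  · rw [((acc_iff _ _).1 hw).1, ((acc_iff _ _).1 hw').1]
  · ext x
    simp [NTM.language, acc_iff]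

end Machines

/-! ### Simulating a given machine inside a structured program -/

section Embeddings

variable {K : Type} {Γ : K → Type} {σ : Type}

/-- Run the program of the list whose index is computed from the register. -/
def Prog.select {ι : Type} [DecidableEq ι] (f : σ → ι) (p : ι → Prog Γ σ) : List ι → Prog Γ σ
  | [] => .skip
  | i :: l => .ite (fun v => decide (f v = i)) (p i) (select f p l)

theorem Runs.select [DecidableEq K] {ι : Type} [DecidableEq ι] {f : σ → ι} {p : ι → Prog Γ σ}
    {l : List ι} {s : State Γ σ} {T : ℕ} {Q : State Γ σ → Prop} (hl : f s.var ∈ l)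
    (h : Runs (p (f s.var)) s T Q) : Runs (.select f p l) s T Q := by
  induction l with
  | nil => cases hl
  | cons i l ih =>
    refine Runs.ite (fun hi => ?_) (fun hi => ih ?_)
    · simp only [decide_eq_true_eq] at hi
      exact hi ▸ h
    · simp only [decide_eq_false_iff_not] at hi
      exact (List.mem_cons.1 hl).resolve_left hi

/-- The way in which a memory contains the configuration of another machine, with stacks indexed
by `K'`, labels in `Λ` and internal states in `τ`. -/
structure Embedding {K : Type} (Γ : K → Type) (σ K' Λ τ : Type) where
  /-- the position of the stacks -/
  e : K' → K
  inj : Function.Injective e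
  /-- read the label and the internal state -/
  get : σ → Option Λ × τ
  /-- write the label and the internal state -/
  put : σ → Option Λ × τ → σ
  get_put : ∀ v a, get (put v a) = a
  put_get : ∀ v, put v (get v) = v
  put_put : ∀ v a b, put (put v a) b = put v b

namespace Embedding

variable {K' Λ τ : Type} (E : Embedding Γ σ K' Λ τ)

/-- The embedded configuration. -/
def cfg (s : State Γ σ) : TM2.Cfg (fun k => Γ (E.e k)) Λ τ :=
  ⟨(E.get s.var).1, (E.get s.var).2, fun k => s.stk (E.e k)⟩

/-- Nothing outside of the embedded configuration has changed. -/
def Frame (s s' : State Γ σ) : Prop :=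
  s'.var = E.put s.var (E.get s'.var) ∧ ∀ k, (∀ k', E.e k' ≠ k) → s'.stk k = s.stk k

theorem Frame.refl (s : State Γ σ) : E.Frame s s := ⟨(E.put_get _).symm, fun _ _ => rfl⟩

variable {E} in
theorem Frame.trans {s s' s'' : State Γ σ} (h : E.Frame s s') (h' : E.Frame s' s'') :
    E.Frame s s'' := by
  refine ⟨?_, fun k hk => (h'.2 k hk).trans (h.2 k hk)⟩
  rw [h'.1, h.1, E.put_put, E.get_put]

/-- A statement of the embedded machine as a program. -/
def translate : TM2.Stmt (fun k => Γ (E.e k)) Λ τ → Prog Γ σ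
  | .push k f q => .seq (.push (E.e k) fun v => f (E.get v).2) (translate q)
  | .peek k f q =>
    .seq (.peek (E.e k) fun v o => E.put v ((E.get v).1, f (E.get v).2 o)) (translate q)
  | .pop k f q =>
    .seq (.pop (E.e k) fun v o => E.put v ((E.get v).1, f (E.get v).2 o)) (translate q)
  | .load f q => .seq (.load fun v => E.put v ((E.get v).1, f (E.get v).2)) (translate q)
  | .branch f q q' => .ite (fun v => f (E.get v).2) (translate q) (translate q')
  | .goto f => .load fun v => E.put v (some (f (E.get v).2), (E.get v).2)
  | .halt => .load fun v => E.put v (none, (E.get v).2)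

variable [DecidableEq K] [DecidableEq K']

/-- A statement is loop-free: `goto` and `halt` merely record the next label in the register. -/
theorem runs_translate (q : TM2.Stmt (fun k => Γ (E.e k)) Λ τ) (s : State Γ σ) :
    Runs (E.translate q) s 0 fun s' =>
      E.cfg s' = TM2.stepAux q (E.cfg s).var (E.cfg s).stk ∧ E.Frame s s' := by
  induction q generalizing s with
  | push k f q ih =>
    refine Runs.seq_zero (Runs.push ((ih _).mono le_rfl ?_))
    rintro s' ⟨h₁, h₂⟩
    refine ⟨?_, Frame.trans ?_ h₂⟩
    · rw [h₁, TM2.stepAux]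
      exact congrArg _ (Function.update_comp_eq_of_injective' _ E.inj _ _)
    · exact ⟨(E.put_get _).symm, fun k' hk' => Function.update_of_ne (Ne.symm (hk' k)) _ _⟩
  | peek k f q ih =>
    refine Runs.seq_zero (Runs.peek ((ih _).mono le_rfl ?_))
    rintro s' ⟨h₁, h₂⟩
    refine ⟨?_, Frame.trans ?_ h₂⟩
    · rw [h₁, TM2.stepAux]
      simp only [cfg, E.get_put]
    · exact ⟨by simp only [E.get_put], fun _ _ => rfl⟩
  | pop k f q ih =>
    refine Runs.seq_zero (Runs.pop ((ih _).mono le_rfl ?_))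
    rintro s' ⟨h₁, h₂⟩
    refine ⟨?_, Frame.trans ?_ h₂⟩
    · rw [h₁, TM2.stepAux]
      simp only [cfg, E.get_put]
      exact congrArg _ (Function.update_comp_eq_of_injective' _ E.inj _ _)
    · exact ⟨by simp only [E.get_put],
        fun k' hk' => Function.update_of_ne (Ne.symm (hk' k)) _ _⟩
  | load f q ih =>
    refine Runs.seq_zero (Runs.load ((ih _).mono le_rfl ?_))
    rintro s' ⟨h₁, h₂⟩
    refine ⟨?_, Frame.trans ?_ h₂⟩
    · rw [h₁, TM2.stepAux]
      simp only [cfg, E.get_put]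
    · exact ⟨by simp only [E.get_put], fun _ _ => rfl⟩
  | branch f q q' ih ih' =>
    refine Runs.ite (fun hf => (ih s).mono le_rfl ?_) (fun hf => (ih' s).mono le_rfl ?_) <;>
    · rintro s' ⟨h₁, h₂⟩
      refine ⟨?_, h₂⟩
      have hf' := hf
      change f (E.cfg s).var = _ at hf'
      simp only [TM2.stepAux, hf', cond_true, cond_false, h₁]
  | goto f => exact Runs.load ⟨by simp [cfg, E.get_put], by simp [Frame, E.get_put]⟩
  | halt => exact Runs.load ⟨by simp [cfg, E.get_put], by simp [Frame, E.get_put]⟩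

/-- Run the embedded deterministic machine with statements `m` until it halts. -/
noncomputable def run [Fintype Λ] [DecidableEq Λ] (m : Λ → TM2.Stmt (fun k => Γ (E.e k)) Λ τ) :
    Prog Γ σ :=
  .loop .skip (fun v => (E.get v).1.isSome) <|
    .select (fun v => (E.get v).1) (fun o => o.elim .skip fun l => E.translate (m l))
      Finset.univ.toList

/-- Each round executes one step of the embedded machine; the additional passage finds that it has
halted. -/
theorem runs_run [Fintype Λ] [DecidableEq Λ] {m : Λ → TM2.Stmt (fun k => Γ (E.e k)) Λ τ} {t : ℕ}
    {s : State Γ σ} {c : TM2.Cfg (fun k => Γ (E.e k)) Λ τ} (h : ReachIn m t (E.cfg s) c)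
    (hc : c.l = none) : Runs (E.run m) s (t + 1) fun s' => E.cfg s' = c ∧ E.Frame s s' := by
  induction t generalizing s with
  | zero =>
    obtain rfl : E.cfg s = c := by simpa [ReachIn] using h
    refine (Runs.loopExit (T := 0) (Runs.skip ⟨?_, rfl, Frame.refl E s⟩)).mono (by simp)
      fun _ h => h
    simpa [cfg] using hc
  | succ t ih =>
    obtain ⟨b, hb, h⟩ := reachIn_succ.1 h
    obtain ⟨l, hl⟩ : ∃ l, (E.get s.var).1 = some l := by
      refine Option.ne_none_iff_exists'.1 fun hl => ?_
      rw [step_eq_none hl] at hb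
      cases hb
    have hb' : TM2.stepAux (m l) (E.cfg s).var (E.cfg s).stk = b := by
      simpa [cfg, hl, TM2.step] using hb
    refine (Runs.loopNext (T := 0) (T' := 0) (T'' := t + 1) (Runs.skip ⟨?_, ?_⟩)).mono (by omega)
      fun _ h => h
    · simp [hl]
    · refine Runs.select (by simp) ?_
      rw [hl]
      refine (E.runs_translate (m l) s).mono le_rfl ?_
      rintro s' ⟨h₁, h₂⟩
      refine (ih (s := s') ?_).mono le_rfl fun s'' hs'' => ⟨hs''.1, h₂.trans hs''.2⟩
      rw [h₁, hb']
      exact h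

end Embedding

end Embeddings

/-! ### Positions of strings, ranks, and the prefix code -/

section Ranks

/-- Add a binary digit at the end of a numeral, most significant digit first. -/
def addDigit (n : ℕ) (b : Bool) : ℕ := Nat.bit b n

/-- The position of a string in the length-first lexicographical order, counted from 1. -/
def index (x : List Bool) : ℕ := x.foldl addDigit 1

theorem le_foldl_addDigit (a : ℕ) (x : List Bool) : a * 2 ^ x.length ≤ x.foldl addDigit a := by
  induction x generalizing a with
  | nil => simp
  | cons b x ih =>
    refine le_trans ?_ (ih _)
    have : 2 * a ≤ addDigit a b := by cases b <;> simp [addDigit]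
    calc a * 2 ^ (x.length + 1) = 2 * a * 2 ^ x.length := by ring
      _ ≤ _ := by gcongr

theorem foldl_addDigit_lt (a : ℕ) (x : List Bool) :
    x.foldl addDigit a < (a + 1) * 2 ^ x.length := by
  induction x generalizing a with
  | nil => simp
  | cons b x ih =>
    refine (ih _).trans_le ?_
    have : addDigit a b + 1 ≤ 2 * (a + 1) := by cases b <;> simp [addDigit]; omega
    calc (addDigit a b + 1) * 2 ^ x.length ≤ 2 * (a + 1) * 2 ^ x.length := by gcongr
      _ = (a + 1) * 2 ^ (x.length + 1) := by ring

theorem foldl_addDigit_lt_of_lex (a : ℕ) {x z : List Bool} (h : List.Lex (· < ·) x z)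
    (hl : x.length = z.length) : x.foldl addDigit a < z.foldl addDigit a := by
  induction h generalizing a with
  | nil => simp at hl
  | cons _ ih => exact ih _ (by simpa using hl)
  | @rel b x c z h =>
    obtain ⟨rfl, rfl⟩ : b = false ∧ c = true := by revert h; cases b <;> cases c <;> decide
    refine (foldl_addDigit_lt _ x).trans_le (le_trans (le_of_eq ?_) (le_foldl_addDigit _ z))
    obtain hl : x.length = z.length := by simpa using hl
    simp [addDigit, hl]

theorem index_pos (x : List Bool) : 0 < index x :=
  lt_of_lt_of_le (by positivity) (le_foldl_addDigit 1 x)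

/-- `index x` has the binary numeral `1x`: a longer string has a longer numeral, and at equal length
the first differing digit decides. -/
theorem index_lt_index {x z : List Bool} (h : List.Shortlex (· < ·) x z) : index x < index z := by
  rcases List.shortlex_def.1 h with h | ⟨hl, h⟩
  · refine (foldl_addDigit_lt 1 x).trans_le (le_trans ?_ (le_foldl_addDigit 1 z))
    calc (1 + 1) * 2 ^ x.length = 2 ^ (x.length + 1) := by ring
      _ ≤ 2 ^ z.length := Nat.pow_le_pow_right (by norm_num) h
      _ = _ := by ring
  · exact foldl_addDigit_lt_of_lex 1 h hl

theorem shortlex_trichotomy (x z : List Bool) :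
    List.Shortlex (· < ·) x z ∨ x = z ∨ List.Shortlex (· < ·) z x := by
  by_contra! h
  exact h.2.1 (Std.Trichotomous.trichotomous (r := List.Shortlex (· < ·)) x z h.1 h.2.2)

theorem index_injective : Function.Injective index := by
  intro x z h
  rcases shortlex_trichotomy x z with h' | h' | h'
  · exact absurd h (index_lt_index h').ne
  · exact h'
  · exact absurd h (index_lt_index h').ne'

theorem index_lt_index_iff {x z : List Bool} :
    index x < index z ↔ List.Shortlex (· < ·) x z := by
  refine ⟨fun h => ?_, index_lt_index⟩
  rcases shortlex_trichotomy x z with h' | rfl | h'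
  · exact h'
  · exact absurd h (lt_irrefl _)
  · exact absurd h (index_lt_index h').not_gt

theorem stringLE_iff {x z : List Bool} : StringLE x z ↔ index x ≤ index z := by
  rw [le_iff_eq_or_lt, index_injective.eq_iff, index_lt_index_iff, StringLE]

theorem index_append (x : List Bool) (b : Bool) : index (x ++ [b]) = Nat.bit b (index x) := by
  simp [index, addDigit]

theorem exists_index_eq {n : ℕ} (hn : 0 < n) : ∃ x, index x = n := by
  induction n using Nat.strong_induction_on with
  | _ n ih =>
    rcases Nat.lt_or_ge n 2 with h | h
    · exact ⟨[], by simp [index]; omega⟩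
    · obtain ⟨x, hx⟩ := ih (n / 2) (by omega) (by omega)
      refine ⟨x ++ [n.bodd], ?_⟩
      rw [index_append, hx, ← Nat.div2_val, Nat.bit_bodd_div2]

theorem ncard_index_le (n : ℕ) : {x | index x ≤ n}.ncard = n := by
  have : index '' {x | index x ≤ n} = Set.Icc 1 n := by
    ext m
    constructor
    · rintro ⟨x, hx, rfl⟩
      exact ⟨index_pos x, hx⟩
    · rintro ⟨h, h'⟩
      obtain ⟨x, rfl⟩ := exists_index_eq h
      exact ⟨x, h', rfl⟩
  rw [← Set.ncard_image_of_injective _ index_injective, this, ← Finset.coe_Icc,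
    Set.ncard_coe_finset, Nat.card_Icc]
  omega

theorem encodeNat_bit (b : Bool) {n : ℕ} (hn : 0 < n) :
    encodeNat (Nat.bit b n) = b :: encodeNat n := by
  have key : ((Nat.bit b n : ℕ) : Num) = cond b Num.bit1 Num.bit0 (n : Num) := by
    rw [← Num.ofNat'_eq, ← Num.ofNat'_eq, Num.ofNat'_bit]
  unfold encodeNat
  rw [key]
  have hn' : (n : Num) ≠ 0 := fun h => by
    have := congrArg (fun m : Num => (m : ℕ)) h
    simp at this
    omega
  cases h : (n : Num) with
  | zero => exact absurd h hn'
  | pos m => cases b <;> rfl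

/-- `encodeNat` lists the least significant digit first, so the numeral `1x` appears reversed.
Positions can thus be output without any arithmetic. -/
theorem encodeNat_index (x : List Bool) : encodeNat (index x) = x.reverse ++ [true] := by
  induction x using List.reverseRecOn with
  | nil => rfl
  | append_singleton x b ih => simp [index_append, encodeNat_bit b (index_pos x), ih]

theorem head?_encodeNat {n : ℕ} (hn : 0 < n) : (encodeNat n).head? = some n.bodd := by
  obtain ⟨x, rfl⟩ := exists_index_eq hn
  induction x using List.reverseRecOn with
  | nil => rfl
  | append_singleton x b => simp [index_append, encodeNat_bit b (index_pos x)]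

theorem rank_add_rank_compl (A : Set (List Bool)) (y : List Bool) :
    rank A y + rank Aᶜ y = index y := by
  rw [← ncard_index_le (index y),
    ← Set.ncard_inter_add_ncard_sdiff_eq_ncard {x | index x ≤ index y} A
      ((finite_stringLE y).subset fun x hx => stringLE_iff.2 hx)]
  simp only [rank, stringLE_iff]
  rfl

/-- The elements of the range up to `y` are the images of an initial segment of strings. The
hypotheses place all images but `Y x` relative to `y`, so only `Y x` is in doubt. -/
theorem rank_range {Y : List Bool → List Bool}
    (hY : ∀ x z, List.Shortlex (· < ·) x z → List.Shortlex (· < ·) (Y x) (Y z)) {x y : List Bool}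
    (h : ∀ z, index z < index x → index (Y z) ≤ index y)
    (h' : ∀ z, index x < index z → index y < index (Y z)) [Decidable (index (Y x) ≤ index y)] :
    rank (Set.range Y) y = if index (Y x) ≤ index y then index x else index x - 1 := by
  have hinj : Function.Injective Y := by
    intro a b hab
    rcases shortlex_trichotomy a b with h | h | h
    · exact absurd (congrArg index hab) (index_lt_index (hY _ _ h)).ne
    · exact h
    · exact absurd (congrArg index hab) (index_lt_index (hY _ _ h)).ne'
  have : {z | StringLE z y ∧ z ∈ Set.range Y} = Y '' {z | index (Y z) ≤ index y} := by
    ext z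
    simp only [stringLE_iff, Set.mem_ofPred_eq, Set.mem_range, Set.mem_image]
    constructor
    · rintro ⟨h, z, rfl⟩
      exact ⟨z, h, rfl⟩
    · rintro ⟨z, h, rfl⟩
      exact ⟨h, z, rfl⟩
  rw [rank, this, Set.ncard_image_of_injective _ hinj]
  split_ifs with hx
  · rw [← ncard_index_le (index x)]
    congr 1
    ext z
    refine ⟨fun hz => not_lt.1 fun hxz => (h' z hxz).not_ge hz, fun hz => ?_⟩
    rcases (show index z ≤ index x from hz).lt_or_eq with hz | hz
    · exact h z hz
    · rw [index_injective hz]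
      exact hx
  · rw [← ncard_index_le (index x - 1)]
    congr 1
    ext z
    simp only [Set.mem_ofPred_eq]
    have := index_pos x
    refine ⟨fun hz => ?_, fun hz => h z (by omega)⟩
    by_contra hxz
    rcases (show index x ≤ index z by omega).lt_or_eq with hxz | hxz
    · exact (h' z hxz).not_ge hz
    · rw [index_injective hxz] at hx
      exact hx hz

/-- The string `1x₁1x₂…1xₙ0z`. -/
def prefixCode : List Bool → List Bool → List Bool
  | [], z => false :: z
  | a :: x, z => true :: a :: prefixCode x z

theorem length_prefixCode (x z : List Bool) :
    (prefixCode x z).length = 2 * x.length + 1 + z.length := by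
  induction x with
  | nil => simp [prefixCode]; omega
  | cons a x ih => simp [prefixCode, ih]; omega

theorem prefixCode_inj {x x' z z' : List Bool} (h : prefixCode x z = prefixCode x' z') :
    x = x' ∧ z = z' := by
  induction x generalizing x' with
  | nil => cases x' <;> simp_all [prefixCode]
  | cons a x ih =>
    cases x' with
    | nil => simp [prefixCode] at h
    | cons a' x' =>
      simp only [prefixCode, List.cons.injEq, true_and] at h
      obtain ⟨rfl, rfl⟩ := ih h.2
      exact ⟨by rw [h.1], rfl⟩

theorem lex_prefixCode {x x' : List Bool} (h : List.Lex (· < ·) x x') (hl : x.length = x'.length)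
    (z z' : List Bool) : List.Lex (· < ·) (prefixCode x z) (prefixCode x' z') := by
  induction h with
  | nil => simp at hl
  | cons _ ih => exact .cons (.cons (ih (by simpa using hl)))
  | rel h => exact .cons (.rel h)

theorem lex_prefixCode_right (x : List Bool) {z z' : List Bool} (h : List.Lex (· < ·) z z') :
    List.Lex (· < ·) (prefixCode x z) (prefixCode x z') := by
  induction x with
  | nil => exact .cons h
  | cons a x ih => exact .cons (.cons ih)

/-- The length of the second part is a monotone function of the length of the first, so the second
parts never influence the order for distinct first parts. -/
theorem shortlex_prefixCode {p : ℕ → ℕ} (hp : Monotone p) {x x' z z' : List Bool}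
    (h : List.Shortlex (· < ·) x x') (hz : z.length = p x.length)
    (hz' : z'.length = p x'.length) :
    List.Shortlex (· < ·) (prefixCode x z) (prefixCode x' z') := by
  rcases List.shortlex_def.1 h with h | ⟨hl, h⟩
  · refine .of_length_lt ?_
    rw [length_prefixCode, length_prefixCode, hz, hz']
    have := hp h.le
    omega
  · refine .of_lex ?_ (lex_prefixCode h hl _ _)
    rw [length_prefixCode, length_prefixCode, hz, hz', hl]

end Ranks

/-! ### Work stacks and a unary clock -/

section Workspace

/-- The stacks of bits used by the programs below. -/
inductive Tape
  | inp | xs | ys | us | vs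
  deriving DecidableEq

instance : Finite Tape :=
  Finite.of_surjective (fun i : Fin 5 => match i with
    | 0 => Tape.inp | 1 => .xs | 2 => .ys | 3 => .us | 4 => .vs) fun t => by
    cases t
    exacts [⟨0, rfl⟩, ⟨1, rfl⟩, ⟨2, rfl⟩, ⟨3, rfl⟩, ⟨4, rfl⟩]

/-- The registers used by the programs below. -/
structure Regs where
  /-- no error has occurred -/
  ok : Bool
  /-- the symbol read last -/
  sym : Option Bool
  /-- a stored bit -/
  bit : Bool

instance : Finite Regs :=
  Finite.of_injective (fun r : Regs => (r.ok, r.sym, r.bit)) fun r r' h => by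
    cases r; cases r'; simp_all

variable {K' : Type} (Γ' : K' → Type)

/-- Bits on the work stacks, and other symbols on further stacks. -/
abbrev Alphabet : Tape ⊕ K' → Type
  | .inl _ => Bool
  | .inr k => Γ' k

variable {Γ'} {τ : Type}

/-- The stacks with the given contents. -/
def contents (i x y u v : List Bool) (S : ∀ k, List (Γ' k)) : ∀ k, List (Alphabet Γ' k)
  | .inl .inp => i
  | .inl .xs => x
  | .inl .ys => y
  | .inl .us => u
  | .inl .vs => v
  | .inr k => S k

section

variable (i x y u v w : List Bool) (S : ∀ k, List (Γ' k))

@[simp] theorem contents_inp : contents i x y u v S (.inl .inp) = i := rfl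
@[simp] theorem contents_xs : contents i x y u v S (.inl .xs) = x := rfl
@[simp] theorem contents_ys : contents i x y u v S (.inl .ys) = y := rfl
@[simp] theorem contents_us : contents i x y u v S (.inl .us) = u := rfl
@[simp] theorem contents_vs : contents i x y u v S (.inl .vs) = v := rfl
@[simp] theorem contents_inr (k : K') : contents i x y u v S (.inr k) = S k := rfl

variable [DecidableEq K']

@[simp] theorem update_contents_inp :
    Function.update (contents i x y u v S) (.inl .inp) w = contents w x y u v S := by
  funext k
  rcases k with (_ | _ | _ | _ | _) | _ <;> rfl

@[simp] theorem update_contents_xs :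
    Function.update (contents i x y u v S) (.inl .xs) w = contents i w y u v S := by
  funext k
  rcases k with (_ | _ | _ | _ | _) | _ <;> rfl

@[simp] theorem update_contents_ys :
    Function.update (contents i x y u v S) (.inl .ys) w = contents i x w u v S := by
  funext k
  rcases k with (_ | _ | _ | _ | _) | _ <;> rfl

@[simp] theorem update_contents_us :
    Function.update (contents i x y u v S) (.inl .us) w = contents i x y w v S := by
  funext k
  rcases k with (_ | _ | _ | _ | _) | _ <;> rfl

@[simp] theorem update_contents_vs :
    Function.update (contents i x y u v S) (.inl .vs) w = contents i x y u w S := by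
  funext k
  rcases k with (_ | _ | _ | _ | _) | _ <;> rfl

@[simp] theorem update_contents_inr (k : K') (w : List (Γ' k)) :
    Function.update (contents i x y u v S) (.inr k) w =
      contents i x y u v (Function.update S k w) := by
  funext k'
  rcases k' with (_ | _ | _ | _ | _) | k' <;> try rfl
  by_cases h : k' = k
  · subst h; simp
  · simp [h]

end

/-- The memory with the given contents. -/
abbrev memory (ok : Bool) (o : Option Bool) (b : Bool) (t : τ) (i x y u v : List Bool)
    (S : ∀ k, List (Γ' k)) : State (Alphabet Γ') (Regs × τ) :=
  ⟨(⟨ok, o, b⟩, t), contents i x y u v S⟩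

/-- Store the symbol read last. -/
abbrev setSym (v : Regs × τ) (o : Option Bool) : Regs × τ := (⟨v.1.ok, o, v.1.bit⟩, v.2)

namespace Prog

/-- Read a symbol from a work stack. -/
abbrev read (a : Tape) : Prog (Alphabet Γ') (Regs × τ) := .pop (.inl a) setSym

/-- Write the symbol read last on a work stack. -/
abbrev write (a : Tape) : Prog (Alphabet Γ') (Regs × τ) :=
  .push (.inl a) fun v => v.1.sym.getD false

/-- Write a constant on a work stack. -/
abbrev writeBit (a : Tape) (b : Bool) : Prog (Alphabet Γ') (Regs × τ) := .push (.inl a) fun _ => b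

/-- Read all symbols of a work stack, and run `p` after each. -/
abbrev forTape (a : Tape) (p : Prog (Alphabet Γ') (Regs × τ)) : Prog (Alphabet Γ') (Regs × τ) :=
  .forEach (.inl a) setSym (fun v => v.1.sym.isSome) p

/-- Repeat a program a constant number of times. -/
def times (p : Prog (Alphabet Γ') (Regs × τ)) : ℕ → Prog (Alphabet Γ') (Regs × τ)
  | 0 => .skip
  | n + 1 => .seq p (times p n)

/-- Put as many symbols on `vs` as there are on `xs`. -/
def addLength : Prog (Alphabet Γ') (Regs × τ) :=
  .seq (forTape .xs (.seq (write .ys) (writeBit .vs true))) (forTape .ys (write .xs))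

/-- Multiply the number of symbols on `us` by the number of symbols on `xs`. -/
def mulLength : Prog (Alphabet Γ') (Regs × τ) :=
  .seq (forTape .us addLength) (forTape .vs (writeBit .us true))

/-- With `n` symbols on `xs`, put `c * n ^ k` symbols on `us`. -/
def clock (c k : ℕ) : Prog (Alphabet Γ') (Regs × τ) :=
  .seq (times (writeBit .us true) c) (times mulLength k)

end Prog

variable [DecidableEq K'] {ok b : Bool} {o : Option Bool} {t : τ} {i x y u v : List Bool}
  {S : ∀ k, List (Γ' k)}

theorem Runs.forTape {a : Tape} {p : Prog (Alphabet Γ') (Regs × τ)} {T T' : ℕ}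
    {s : State (Alphabet Γ') (Regs × τ)} {Q : State (Alphabet Γ') (Regs × τ) → Prop}
    {l : List Bool} (I : List Bool → State (Alphabet Γ') (Regs × τ) → Prop) (h : I l s)
    (hT : l.length * (T + 1) + 1 ≤ T') (hI : ∀ l s, I l s → s.stk (.inl a) = l)
    (hstep : ∀ c l s, I (c :: l) s →
      Runs p ⟨setSym s.var (some c), Function.update s.stk (.inl a) l⟩ T (I l))
    (hend : ∀ s, I [] s → Q ⟨setSym s.var none, s.stk⟩) : Runs (.forTape a p) s T' Q :=
  Runs.le (Runs.forEach (c := fun v : Regs × τ => v.1.sym.isSome) (fun _ _ => rfl) I hI hstep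
    hend h) hT

theorem runs_addLength :
    Runs .addLength (memory ok o b t i x [] u v S) (2 * x.length + 2) fun s =>
      ∃ o, s = memory ok o b t i x [] u (List.replicate x.length true ++ v) S := by
  refine Runs.le (Runs.seq (T := x.length + 1) (T' := x.length + 1) ?_) (by omega)
  refine Runs.forTape (T := 0) (l := x)
    (fun l s => ∃ o y v', s = memory ok o b t i l y u v' S ∧ l.reverse ++ y = x.reverse ∧
      List.replicate l.length true ++ v' = List.replicate x.length true ++ v)
    ⟨o, [], v, rfl, by simp, rfl⟩ (by simp) ?_ ?_ ?_
  · rintro l s ⟨o, y, v, rfl, -⟩; rfl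
  · rintro a l s ⟨o, y, v', rfl, hy, hv⟩
    refine Runs.seq_zero (Runs.push (Runs.push ?_))
    refine ⟨some a, a :: y, true :: v', by simp, by simpa using hy, ?_⟩
    rw [← hv]
    simp [List.replicate_succ']
  · rintro s ⟨o, y, v', rfl, hy, hv⟩
    simp only [List.reverse_nil, List.nil_append, List.length_nil, List.replicate_zero] at hy hv
    subst hy hv
    refine Runs.forTape (T := 0) (l := x.reverse)
      (fun l s => ∃ o y, s = memory ok o b t i y l u (List.replicate x.length true ++ v) S ∧
        l.reverse ++ y = x)
      ⟨_, _, rfl, by simp⟩ (by simp) ?_ ?_ ?_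
    · rintro l s ⟨o, y, rfl, -⟩; rfl
    · rintro a l s ⟨o, y, rfl, hy⟩
      exact Runs.push ⟨some a, a :: y, by simp, by simpa using hy⟩
    · rintro s ⟨o, y, rfl, hy⟩
      simp only [List.reverse_nil, List.nil_append] at hy
      subst hy
      exact ⟨_, rfl⟩

theorem runs_mulLength {m : ℕ} :
    Runs .mulLength (memory ok o b t i x [] (List.replicate m true) [] S)
      (m * (3 * x.length + 3) + 2) fun s =>
      ∃ o, s = memory ok o b t i x [] (List.replicate (m * x.length) true) [] S := by
  refine Runs.le (Runs.seq (T := m * (2 * x.length + 3) + 1) (T' := m * x.length + 1) ?_)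
    (by nlinarith)
  refine Runs.forTape (T := 2 * x.length + 2) (l := List.replicate m true)
    (fun l s => ∃ o v, s = memory ok o b t i x [] l v S ∧
      List.replicate (l.length * x.length) true ++ v = List.replicate (m * x.length) true)
    ⟨o, [], rfl, by simp⟩ (by simp) ?_ ?_ ?_
  · rintro l s ⟨o, v, rfl, -⟩; rfl
  · rintro a l s ⟨o, v, rfl, hv⟩
    simp only [update_contents_us]
    refine runs_addLength.mono le_rfl ?_
    rintro s ⟨o, rfl⟩
    refine ⟨o, _, rfl, ?_⟩
    rw [← hv, List.length_cons, add_mul, one_mul, List.replicate_add, List.append_assoc]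
  · rintro s ⟨o, v, rfl, hv⟩
    simp only [List.length_nil, zero_mul, List.nil_append, List.replicate_zero] at hv
    subst hv
    refine Runs.forTape (T := 0) (l := List.replicate (m * x.length) true)
      (fun l s => ∃ o u, s = memory ok o b t i x [] u l S ∧
        List.replicate l.length true ++ u = List.replicate (m * x.length) true)
      ⟨_, _, rfl, by simp⟩ (by simp) ?_ ?_ ?_
    · rintro l s ⟨o, y, rfl, -⟩; rfl
    · rintro a l s ⟨o, u, rfl, hy⟩
      refine Runs.push ⟨some a, true :: u, by simp, ?_⟩
      rw [← hy]
      simp [List.replicate_succ']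
    · rintro s ⟨o, u, rfl, hy⟩
      simp only [List.length_nil, List.replicate_zero, List.nil_append] at hy
      subst hy
      exact ⟨_, rfl⟩

theorem runs_times_mulLength {m k : ℕ} (hx : 0 < x.length) :
    Runs (.times .mulLength k) (memory ok o b t i x [] (List.replicate m true) [] S)
      (k * (m * x.length ^ k * (3 * x.length + 3) + 2)) fun s =>
      ∃ o, s = memory ok o b t i x [] (List.replicate (m * x.length ^ k) true) [] S := by
  induction k generalizing o m with
  | zero => exact Runs.skip ⟨o, by simp⟩
  | succ k ih =>
    refine (Runs.seq (runs_mulLength.mono le_rfl ?_)).mono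
      (T := _ + k * (m * x.length * x.length ^ k * (3 * x.length + 3) + 2)) ?_ fun _ h => h
    · rintro s ⟨o, rfl⟩
      refine ih.mono le_rfl ?_
      rintro s ⟨o, rfl⟩
      exact ⟨o, by rw [mul_assoc, ← pow_succ']⟩
    -- As `x` is nonempty, the products only grow, and the bound for the final one covers every
    -- round.
    · have : m ≤ m * x.length ^ (k + 1) := Nat.le_mul_of_pos_right _ (by positivity)
      have : m * (3 * x.length + 3) ≤ m * x.length ^ (k + 1) * (3 * x.length + 3) := by gcongr
      rw [mul_assoc m x.length, ← pow_succ', add_mul k 1]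
      omega

theorem runs_clock {c k : ℕ} (hx : 0 < x.length) :
    Runs (.clock c k) (memory ok o b t i x [] [] [] S)
      (k * (c * x.length ^ k * (3 * x.length + 3) + 2)) fun s =>
      ∃ o, s = memory ok o b t i x [] (List.replicate (c * x.length ^ k) true) [] S := by
  refine Runs.seq_zero ?_
  suffices h : ∀ u, Runs (.times (.writeBit .us true) c) (memory ok o b t i x [] u [] S) 0
      fun s => s = memory ok o b t i x [] (List.replicate c true ++ u) [] S by
    refine (h []).mono le_rfl ?_
    rintro s rfl
    simpa using runs_times_mulLength hx
  induction c with
  | zero => exact fun u => Runs.skip (by simp)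
  | succ c ih =>
    intro u
    refine Runs.seq_zero (Runs.push ?_)
    simp only [contents_us, update_contents_us]
    refine (ih _).mono le_rfl ?_
    rintro s rfl
    simp [List.replicate_succ']

end Workspace

/-! ### Calling a deterministic machine; P is contained in UP and coUP -/

section Subroutines

theorem ofInput_inl {K' : Type} [DecidableEq K'] {Γ' : K' → Type} {τ : Type} (ok b : Bool)
    (o : Option Bool) (t : τ) (l : List Bool) :
    State.ofInput (Γ := Alphabet Γ') ((⟨ok, o, b⟩, t) : Regs × τ) (.inl .inp) l =
      memory ok o b t l [] [] [] [] fun _ => [] := by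
  refine State.ext rfl (funext fun k => ?_)
  rcases k with (_ | _ | _ | _ | _) | _ <;> rfl

theorem ofInput_inr {K' : Type} [DecidableEq K'] {Γ' : K' → Type} {τ : Type} (ok b : Bool)
    (o : Option Bool) (t : τ) (k : K') (l : List (Γ' k)) :
    State.ofInput (Γ := Alphabet Γ') ((⟨ok, o, b⟩, t) : Regs × τ) (.inr k) l =
      memory ok o b t [] [] [] [] [] (Function.update (fun _ => []) k l) := by
  refine State.ext rfl ?_
  have : (fun _ => [] : ∀ k, List (Alphabet Γ' k)) = contents [] [] [] [] [] fun _ => [] := by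
    funext k
    rcases k with (_ | _ | _ | _ | _) | _ <;> rfl
  rw [State.ofInput, this]
  exact update_contents_inr _ _ _ _ _ _ _ _

variable (tm : FinTM2)

/-- A machine as a subroutine. -/
def subroutine : Embedding (Alphabet tm.Γ) (Regs × (Option tm.Λ × tm.σ)) tm.K tm.Λ tm.σ where
  e := Sum.inr
  inj := Sum.inr_injective
  get v := v.2
  put v a := (v.1, a)
  get_put _ _ := rfl
  put_get _ := rfl
  put_put _ _ _ := rfl

open Classical in
/-- Run the machine until it halts. -/
noncomputable def Prog.call : Prog (Alphabet tm.Γ) (Regs × (Option tm.Λ × tm.σ)) :=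
  letI := tm.ΛFin
  (subroutine tm).run tm.m

/-- The frame condition protects the registers and work stacks, and the halting convention leaves
only the output on the stacks of the machine. -/
theorem runs_call {tm : FinTM2} {l : List (tm.Γ tm.k₀)} {l' : List (tm.Γ tm.k₁)} {T : ℕ}
    (h : TM2OutputsInTime tm l (some l') T) {ok b : Bool} {o : Option Bool}
    {i x y u v : List Bool} :
    Runs (.call tm) (memory ok o b (some tm.main, tm.initialState) i x y u v
      (Function.update (fun _ => []) tm.k₀ l)) (T + 1) fun s =>
      s = memory ok o b (none, tm.initialState) i x y u v
        (Function.update (fun _ => []) tm.k₁ l') := by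
  obtain ⟨⟨t, ht⟩, htT⟩ := h
  replace ht : (flip bind (TM2.step tm.m))^[t] (some (initList tm l)) =
    some (haltList tm l') := ht
  rw [initList_eq, haltList_eq] at ht
  let := tm.ΛFin
  classical
  refine ((subroutine tm).runs_run (m := tm.m) (t := t)
    (s := memory ok o b (some tm.main, tm.initialState) i x y u v
      (Function.update (fun _ => []) tm.k₀ l))
    (c := ⟨none, tm.initialState, Function.update (fun _ => []) tm.k₁ l'⟩) ht rfl).mono
    (by simpa using htT) ?_
  rintro ⟨⟨r, t⟩, S⟩ ⟨h, h', h''⟩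
  obtain ⟨rfl, rfl⟩ : r = ⟨ok, o, b⟩ ∧ t = (none, tm.initialState) := by
    refine ⟨congrArg Prod.fst h', Prod.ext ?_ ?_⟩
    · exact congrArg TM2.Cfg.l h
    · exact congrArg TM2.Cfg.var h
  refine State.ext rfl (funext fun k => ?_)
  rcases k with k | k
  · refine (h'' (.inl k) fun k' hk' => by cases hk').trans ?_
    cases k <;> rfl
  · exact congrFun (congrArg TM2.Cfg.stk h) k

/-- Sets in P and their complements are in UP. -/
theorem mem_classUP_of_mem_classP {A : Set (List Bool)} (hA : A ∈ classP) :
    A ∈ classUP ∧ Aᶜ ∈ classUP := by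
  obtain ⟨c⟩ := hA
  have : Fintype c.tm.K := c.tm.kFin
  have : Fintype c.tm.Λ := c.tm.ΛFin
  have : Fintype c.tm.σ := c.tm.σFin
  let p : Prog (Alphabet c.tm.Γ) (Regs × (Option c.tm.Λ × c.tm.σ)) :=
    .seq (.call c.tm) (.pop (.inr c.tm.k₁) fun v o => setSym v (o.map c.outputAlphabet))
  have hp : ∀ x, Runs p (.ofInput (⟨true, none, true⟩, (some c.tm.main, c.tm.initialState))
      (.inr c.tm.k₀) (x.map c.inputAlphabet.symm)) ((c.time + 1).eval x.length)
      fun s => s.var.1.sym = some true ↔ x ∈ A := by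
    intro x
    rw [ofInput_inr]
    refine Runs.le (Runs.seq (T' := 0) ((runs_call (c.outputsFun x)).mono le_rfl ?_)) (by simp)
    rintro s rfl
    exact Runs.pop (by simp [encodeBool, Function.update_self])
  -- One program serves for both sets; only the accepting registers differ.
  refine ⟨mem_classUP_of_runs (Γ := Alphabet c.tm.Γ) (.inr c.tm.k₀) c.inputAlphabet _
      {v : Regs × _ | v.1.sym = some true} p (c.time + 1) hp,
    mem_classUP_of_runs (Γ := Alphabet c.tm.Γ) (.inr c.tm.k₀) c.inputAlphabet _
      {v : Regs × _ | v.1.sym ≠ some true} p (c.time + 1)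
      fun x => (hp x).mono le_rfl fun s hs => not_congr hs⟩

end Subroutines

/-! ### Deciding membership by one query to a ranking function -/

section Query

/-- The answer that the value of a function at the query for `x` gives. -/
def answer (g : List Bool → List Bool) (Z : ℕ) (x : List Bool) : Bool :=
  let r := g (prefixCode x (false :: List.replicate Z true))
  -- A first bit 1 announces a rank. The next bit is the parity of this rank, and the head of the
  -- reversed numeral `1x` is the parity of `index x`.
  r.head? == some true && r.tail.head? == (x.reverse ++ [true]).head?

theorem foldl_reverse_eq_prefixCode (x z : List Bool) :
    x.reverse.foldl (fun w a => true :: a :: w) (false :: z) = prefixCode x z := by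
  rw [List.foldl_reverse]
  induction x with
  | nil => rfl
  | cons a x ih => simp [prefixCode, ih]

variable {K' : Type} [DecidableEq K'] {Γ' : K' → Type} {τ : Type}

/-- Move the reversed input on top of a final bit on `xs`. -/
def Prog.loadInput : Prog (Alphabet Γ') (Regs × τ) :=
  .seq (.writeBit .xs true) (.forTape .inp (.write .xs))

theorem runs_loadInput {ok b : Bool} {o : Option Bool} {t : τ} {x y u v : List Bool}
    {S : ∀ k, List (Γ' k)} :
    Runs .loadInput (memory ok o b t x [] y u v S) (x.length + 1) fun s =>
      ∃ o, s = memory ok o b t [] (x.reverse ++ [true]) y u v S := by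
  refine Runs.seq_zero (Runs.push ?_)
  refine Runs.forTape (T := 0) (l := x)
    (fun l s => ∃ o z, s = memory ok o b t l z y u v S ∧ l.reverse ++ z = x.reverse ++ [true])
    ⟨o, [true], by simp, rfl⟩ (by simp) ?_ ?_ ?_
  · rintro l s ⟨o, z, rfl, -⟩; rfl
  · rintro a l s ⟨o, z, rfl, hz⟩
    exact Runs.push ⟨some a, a :: z, by simp, by simpa using hz⟩
  · rintro s ⟨o, z, rfl, hz⟩
    simp only [List.reverse_nil, List.nil_append] at hz
    subst hz
    exact ⟨_, rfl⟩

/-- Write the query on the stack `k`, when `us` and `xs` are prepared. -/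
def Prog.query (k : K') (e : Γ' k ≃ Bool) : Prog (Alphabet Γ') (Regs × τ) :=
  .seq (.forTape .us (.push (.inr k) fun _ => e.symm true)) <|
  .seq (.push (.inr k) fun _ => e.symm false) <|
  -- The lower of the two bits 0 is the bit that follows the code of `x` in the query; the upper one
  -- terminates this code.
  .seq (.push (.inr k) fun _ => e.symm false) <|
  -- The top of `xs` is the last digit of the numeral `1x`, kept for the comparison of parities.
  .seq (.peek (.inl .xs) fun v o => (⟨v.1.ok, v.1.sym, o.getD false⟩, v.2)) <|
  .seq (.forTape .xs <| .seq (.push (.inr k) fun v => e.symm (v.1.sym.getD false))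
    (.push (.inr k) fun _ => e.symm true)) <|
  -- The final bit on `xs`, which does not belong to `x`, has been coded as well; its two symbols
  -- are removed.
  .seq (.pop (.inr k) fun v _ => v) (.pop (.inr k) fun v _ => v)

theorem runs_query (k : K') (e : Γ' k ≃ Bool) {ok b : Bool} {o : Option Bool} {t : τ}
    {x : List Bool} {Z : ℕ} :
    Runs (.query k e) (memory ok o b t [] (x.reverse ++ [true]) [] (List.replicate Z true) []
      (fun _ => [])) (Z + 1 + (x.length + 2)) fun s =>
      ∃ o, s = memory ok o (((x.reverse ++ [true]).head?).getD false) t [] [] [] [] []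
        (Function.update (fun _ => []) k
          ((prefixCode x (false :: List.replicate Z true)).map e.symm)) := by
  refine Runs.seq (Runs.forTape (T := 0) (l := List.replicate Z true)
    (fun l s => ∃ o w, s = memory ok o b t [] (x.reverse ++ [true]) [] l []
        (Function.update (fun _ => []) k (w.map e.symm)) ∧
      List.replicate l.length true ++ w = List.replicate Z true)
    ⟨o, [], by simp, by simp⟩ (by simp) ?_ ?_ ?_)
  · rintro l s ⟨o, w, rfl, -⟩; rfl
  · rintro a l s ⟨o, w, rfl, hw⟩
    refine Runs.push ⟨some a, true :: w, by simp, ?_⟩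
    rw [← hw]
    simp [List.replicate_succ']
  · rintro s ⟨o, w, rfl, hw⟩
    simp only [List.length_nil, List.replicate_zero, List.nil_append] at hw
    subst hw
    refine Runs.seq_zero (Runs.push (Runs.seq_zero (Runs.push (Runs.seq_zero (Runs.peek ?_)))))
    simp only [contents_xs, contents_inr, update_contents_inr, Function.update_self,
      Function.update_idem]
    generalize ((x.reverse ++ [true]).head?).getD false = b'
    refine Runs.le (Runs.seq (T := x.length + 2) (T' := 0) ?_) (by simp)
    refine Runs.forTape (T := 0) (l := x.reverse ++ [true])
      (fun l s => ∃ o w, s = memory ok o b' t [] l [] [] []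
          (Function.update (fun _ => []) k (w.map e.symm)) ∧
        l.foldl (fun w a => true :: a :: w) w =
          true :: true :: prefixCode x (false :: List.replicate Z true))
      ⟨none, false :: false :: List.replicate Z true, rfl, ?_⟩ (by simp) ?_ ?_ ?_
    · rw [List.foldl_append, foldl_reverse_eq_prefixCode]
      rfl
    · rintro l s ⟨o, w, rfl, -⟩; rfl
    · rintro a l s ⟨o, w, rfl, hw⟩
      exact Runs.seq_zero (Runs.push (Runs.push ⟨some a, true :: a :: w, by simp, hw⟩))
    · rintro s ⟨o, w, rfl, hw⟩
      simp only [List.foldl_nil] at hw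
      subst hw
      exact Runs.seq_zero (Runs.pop (Runs.pop ⟨none, by simp⟩))

/-- Run the machine, and compare its output with the stored bit. -/
noncomputable def Prog.compare (tm : FinTM2) (e : tm.Γ tm.k₁ ≃ Bool) :
    Prog (Alphabet tm.Γ) (Regs × (Option tm.Λ × tm.σ)) :=
  .seq (.call tm) <|
  .seq (.pop (.inr tm.k₁) fun v o => (⟨o.map e == some true, v.1.sym, v.1.bit⟩, v.2)) <|
  .seq (.pop (.inr tm.k₁) fun v o => setSym v (o.map e))
    (.push (.inl .vs) fun v => v.1.ok && v.1.sym == some v.1.bit)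

open Polynomial in
/-- With the help of a function computable in polynomial time, the answer to one query of
polynomial length is found in polynomial time. -/
theorem polyTime_answer {g : List Bool → List Bool} (hg : g ∈ FP) (c k : ℕ) :
    Nonempty (TM2ComputableInPolyTime (id : List Bool → List Bool) encodeBool
      fun x => answer g (c * (x.length + 1) ^ k) x) := by
  obtain ⟨M⟩ := hg
  have : Fintype M.tm.K := M.tm.kFin
  have : Fintype M.tm.Λ := M.tm.ΛFin
  have : Fintype M.tm.σ := M.tm.σFin
  let p : Prog (Alphabet M.tm.Γ) (Regs × (Option M.tm.Λ × M.tm.σ)) :=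
    .seq .loadInput <| .seq (.clock c k) <|
    .seq (.query M.tm.k₀ M.inputAlphabet) (.compare M.tm M.outputAlphabet)
  -- The clock measures `xs`, which holds one bit more than `x`; hence the base `X + 1`.
  let Z : ℕ[X] := C c * (X + 1) ^ k
  refine nonempty_polyTime_of_runs (Γ := Alphabet M.tm.Γ) (.inl .inp) (.inl .vs)
    (Equiv.refl Bool) (Equiv.refl Bool) (⟨true, none, true⟩, (some M.tm.main, M.tm.initialState))
    (fun v b => (⟨b, v.1.sym, v.1.bit⟩, v.2)) (fun v => v.1.ok) (fun _ _ => rfl) p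
    ((X + 1) + (C k * (Z * (3 * (X + 1) + 3) + 2) + ((Z + 1 + (X + 2)) +
      (M.time.comp (2 * X + 1 + (Z + 1)) + 1)))) fun x => ?_
  simp only [Equiv.refl_symm, Equiv.coe_refl, List.map_id]
  rw [ofInput_inl]
  have hZ : Z.eval x.length = c * (x.length + 1) ^ k := by simp [Z]
  simp only [eval_add, eval_mul, eval_X, eval_one, eval_C, eval_ofNat, eval_comp, hZ]
  refine Runs.seq (runs_loadInput.mono le_rfl ?_)
  rintro s ⟨o, rfl⟩
  have hc := runs_clock (K' := M.tm.K) (Γ' := M.tm.Γ) (c := c) (k := k) (ok := true) (b := true)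
    (o := o) (t := (some M.tm.main, M.tm.initialState)) (i := []) (x := x.reverse ++ [true])
    (S := fun _ => []) (by simp)
  simp only [List.length_append, List.length_reverse, List.length_singleton] at hc
  refine Runs.seq (hc.mono le_rfl ?_)
  rintro s ⟨o, rfl⟩
  refine Runs.seq ((runs_query _ _).mono le_rfl ?_)
  rintro s ⟨o, rfl⟩
  have hq := M.outputsFun (prefixCode x (false :: List.replicate (c * (x.length + 1) ^ k) true))
  simp only [id, length_prefixCode, List.length_cons, List.length_replicate] at hq
  refine Runs.le (Runs.seq (T' := 0) ((runs_call hq).mono le_rfl ?_)) le_rfl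
  rintro s rfl
  refine Runs.seq_zero (Runs.pop (Runs.seq_zero (Runs.pop (Runs.push ?_))))
  simp only [contents_inr, update_contents_inr, Function.update_self, contents_vs,
    encodeBool, answer]
  generalize g _ = r
  have hh : (x.reverse ++ [true]).head? = some (((x.reverse ++ [true]).head?).getD false) := by
    cases x.reverse <;> simp
  rw [hh]
  rcases r with _ | ⟨r₁, _ | ⟨r₂, r⟩⟩ <;> simp [pure]

end Query

/-! ### Accepting paths as bit strings of prescribed length -/

namespace NTM

instance (N : NTM) : DecidableEq N.K := N.decEqK
instance (N : NTM) : Fintype N.K := N.finK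
instance (N : NTM) : Fintype N.Λ := N.finΛ
instance (N : NTM) : Fintype N.σ := N.finσ

variable (N : NTM)

/-- An accepting path from a given configuration. -/
def AcceptingFrom (c : N.Cfg) (w : List ℕ) : Prop :=
  ∃ c', w.foldlM N.step c = some c' ∧ c'.l = none ∧ c'.var ∈ N.accept

/-- The bits encode an accepting path from the configuration `c`, when the choice of the next
alternative starts at number `j`: the bit 1 passes to the next alternative, the bit 0 executes
it, and after halting only the bit 0 may follow. -/
def Accepts (d : ℕ) : N.Cfg → ℕ → List Bool → Prop
  | c, _, [] => c.l = none ∧ c.var ∈ N.accept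
  | c, j, a :: l =>
    (c.l = none ∧ a = false ∧ Accepts d c j l) ∨
    (c.l ≠ none ∧ a = true ∧ j < d ∧ Accepts d c (j + 1) l) ∨
    (c.l ≠ none ∧ a = false ∧ ∃ c', N.step c j = some c' ∧ Accepts d c' 0 l)

/-- The unary code of a path. -/
def codePath (w : List ℕ) : List Bool := w.flatMap fun i => List.replicate i true ++ [false]

variable {N}

theorem eq_nil_of_acceptingFrom {c : N.Cfg} {w : List ℕ} (hc : c.l = none)
    (h : N.AcceptingFrom c w) : w = [] := by
  cases w with
  | nil => rfl
  | cons i w =>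
    obtain ⟨c', h, -⟩ := h
    have : N.step c i = none := by simp [step, hc]
    have h : (N.step c i).bind (fun c => w.foldlM N.step c) = some c' := h
    simp [this] at h

/-- Only zeros may follow after halting, so a witness is the code of an accepting path with padding.
The `j` ones put in front are those already read for the pending choice. -/
theorem Accepts.exists_path {d : ℕ} {l : List Bool} {c : N.Cfg} {j : ℕ} (h : N.Accepts d c j l)
    (hj : c.l = none → j = 0) : ∃ w r,
      List.replicate j true ++ l = codePath w ++ List.replicate r false ∧ N.AcceptingFrom c w := by
  induction l generalizing c j with
  | nil =>
    obtain rfl := hj h.1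
    exact ⟨[], 0, rfl, c, rfl, h⟩
  | cons a l ih =>
    rcases h with ⟨hc, rfl, h⟩ | ⟨hc, rfl, -, h⟩ | ⟨hc, rfl, c', hs, h⟩
    · obtain rfl := hj hc
      obtain ⟨w, r, hw, ha⟩ := ih h fun _ => rfl
      obtain rfl := eq_nil_of_acceptingFrom hc ha
      refine ⟨[], r + 1, ?_, ha⟩
      simp only [List.replicate_zero, List.nil_append, codePath, List.flatMap_nil] at hw
      simp [hw, codePath, List.replicate_succ]
    · obtain ⟨w, r, hw, ha⟩ := ih h fun h => absurd h hc
      refine ⟨w, r, ?_, ha⟩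
      rw [← hw, List.replicate_succ']
      simp
    · obtain ⟨w, r, hw, c'', h₁, h₂⟩ := ih h fun _ => rfl
      refine ⟨j :: w, r, ?_, c'', ?_, h₂⟩
      · simp only [List.replicate_zero, List.nil_append] at hw
        simp [hw, codePath]
      · change (N.step c j).bind (fun c => w.foldlM N.step c) = _
        rw [hs]
        exact h₁

theorem accepts_replicate_false {d : ℕ} {c : N.Cfg} (hc : c.l = none) (hv : c.var ∈ N.accept)
    (r : ℕ) : N.Accepts d c 0 (List.replicate r false) := by
  induction r with
  | zero => exact ⟨hc, hv⟩
  | succ r ih => exact Or.inl ⟨hc, rfl, ih⟩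

theorem accepts_replicate_true {d : ℕ} {c : N.Cfg} (hc : c.l ≠ none) {i j : ℕ} {l : List Bool}
    (hi : j + i ≤ d) (h : N.Accepts d c (j + i) l) :
    N.Accepts d c j (List.replicate i true ++ l) := by
  induction i generalizing j with
  | zero => exact h
  | succ i ih =>
    refine Or.inr (Or.inl ⟨hc, rfl, by omega, ih (by omega) ?_⟩)
    rwa [add_assoc, add_comm 1 i]

theorem AcceptingFrom.accepts {d : ℕ} (hd : ∀ c i c', N.step c i = some c' → i ≤ d) {c : N.Cfg}
    {w : List ℕ} (h : N.AcceptingFrom c w) (r : ℕ) :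
    N.Accepts d c 0 (codePath w ++ List.replicate r false) := by
  induction w generalizing c with
  | nil =>
    obtain ⟨c', h, h'⟩ := h
    obtain rfl : c = c' := Option.some.inj h
    exact accepts_replicate_false h'.1 h'.2 r
  | cons i w ih =>
    obtain ⟨c', h, h'⟩ := h
    change (N.step c i).bind (fun c => w.foldlM N.step c) = _ at h
    obtain ⟨c₁, h₁, h⟩ := Option.bind_eq_some_iff.1 h
    have hc : c.l ≠ none := fun hc => by simp [step, hc] at h₁
    have : codePath (i :: w) ++ List.replicate r false =
        List.replicate i true ++ false :: (codePath w ++ List.replicate r false) := by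
      simp [codePath]
    rw [this]
    refine accepts_replicate_true hc (by simpa using hd _ _ _ h₁) ?_
    refine Or.inr (Or.inr ⟨hc, rfl, c₁, ?_, ih ⟨c', h, h'⟩⟩)
    simpa using h₁

theorem length_codePath_le {d : ℕ} {w : List ℕ} (h : ∀ i ∈ w, i ≤ d) :
    (codePath w).length ≤ w.length * (d + 1) := by
  induction w with
  | nil => simp [codePath]
  | cons i w ih =>
    have h₁ := ih fun i hi => h i (List.mem_cons_of_mem _ hi)
    have h₂ := h i List.mem_cons_self
    simp only [codePath, List.flatMap_cons, List.length_append, List.length_replicate,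
      List.length_cons, List.length_nil] at h₁ ⊢
    linarith

-- There are finitely many labels, so the number of an alternative fits into a finite register.
variable (N) in
theorem exists_bound : ∃ d, ∀ c i c', N.step c i = some c' → i ≤ d := by
  refine ⟨Finset.univ.sup fun l => (N.m l).length, fun c i c' h => ?_⟩
  obtain ⟨l, -, h⟩ := Option.bind_eq_some_iff.1 h
  obtain ⟨q, hq, -⟩ := Option.map_eq_some_iff.1 h
  have := (List.getElem?_eq_some_iff.1 hq).1
  exact this.le.trans (Finset.le_sup (f := fun l => (N.m l).length) (Finset.mem_univ l))

theorem mem_le_of_foldlM {d : ℕ} (hd : ∀ c i c', N.step c i = some c' → i ≤ d) {w : List ℕ}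
    {c c' : N.Cfg} (h : w.foldlM N.step c = some c') : ∀ i ∈ w, i ≤ d := by
  induction w generalizing c with
  | nil => simp
  | cons j w ih =>
    change (N.step c j).bind (fun c => w.foldlM N.step c) = _ at h
    obtain ⟨c₁, h₁, h⟩ := Option.bind_eq_some_iff.1 h
    intro i hi
    rcases List.mem_cons.1 hi with rfl | hi
    · exact hd _ _ _ h₁
    · exact ih h i hi

/-- The bits encode an accepting path on the input `x`. -/
def IsWitness (N : NTM) (d : ℕ) (x l : List Bool) : Prop := N.Accepts d (N.init x) 0 l

theorem IsWitness.mem_language {d : ℕ} {x l : List Bool} (h : N.IsWitness d x l) :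
    x ∈ N.language := by
  obtain ⟨w, _, _, hw⟩ := h.exists_path fun _ => rfl
  exact ⟨w, hw⟩

/-- Unambiguity fixes the path, and the length fixes the padding. -/
theorem Unambiguous.eq_of_isWitness (hN : N.Unambiguous) {d : ℕ} {x l l' : List Bool}
    (h : N.IsWitness d x l) (h' : N.IsWitness d x l') (hl : l.length = l'.length) : l = l' := by
  obtain ⟨w, r, hw, ha⟩ := h.exists_path fun _ => rfl
  obtain ⟨w', r', hw', ha'⟩ := h'.exists_path fun _ => rfl
  obtain rfl : w = w' := hN x w w' ha ha'
  simp only [List.replicate_zero, List.nil_append] at hw hw'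
  subst hw hw'
  obtain rfl : r = r' := by simpa using hl
  rfl

theorem exists_isWitness {d : ℕ} (hd : ∀ c i c', N.step c i = some c' → i ≤ d)
    {P : Polynomial ℕ} (hP : ∀ x w, (N.run x w).isSome → w.length ≤ P.eval x.length)
    {x : List Bool} (hx : x ∈ N.language) {Z : ℕ} (hZ : P.eval x.length * (d + 1) ≤ Z) :
    ∃ l, l.length = Z ∧ N.IsWitness d x l := by
  obtain ⟨w, hw⟩ := hx
  refine ⟨codePath w ++ List.replicate (Z - (codePath w).length) false, ?_,
    AcceptingFrom.accepts hd hw _⟩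
  obtain ⟨c, hc, -⟩ := hw
  have h₁ := hP x w (by rw [hc]; rfl)
  have h₂ := length_codePath_le (mem_le_of_foldlM hd hc)
  have h₃ : w.length * (d + 1) ≤ P.eval x.length * (d + 1) := by gcongr
  simp
  omega

end NTM

/-! ### Programs that parse an input and check a witness -/

section Ranker

variable (M : Bool → NTM) (d : ℕ)

/-- The stack alphabets of two machines. -/
abbrev PairAlphabet (p : Σ b, (M b).K) : Type := (M p.1).Γ p.2

/-- The labels and internal states of two machines, each with the number of an alternative. -/
abbrev PairState : Type := ∀ b, (Option (M b).Λ × (M b).σ) × Fin (d + 1)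

/-- The memory of one of two machines. -/
def pairEmbedding (b : Bool) :
    Embedding (Alphabet (PairAlphabet M)) (Regs × PairState M d) (M b).K (M b).Λ (M b).σ where
  e k := .inr ⟨b, k⟩
  inj k k' h := by simpa using h
  get v := (v.2 b).1
  put v a := (v.1, Function.update v.2 b (a, (v.2 b).2))
  get_put v a := by simp
  put_get v := by simp
  put_put v a a' := by simp

variable {M d}

/-- Set the number of the next alternative. -/
abbrev setChoice (b : Bool) (v : Regs × PairState M d) (j : Fin (d + 1)) : Regs × PairState M d :=
  (v.1, Function.update v.2 b ((v.2 b).1, j))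

/-- Report an error unless a condition holds. -/
abbrev require {τ : Type} (c : Bool) (v : Regs × τ) : Regs × τ :=
  (⟨v.1.ok && c, v.1.sym, v.1.bit⟩, v.2)

theorem cfg_setChoice (b : Bool) (v : Regs × PairState M d) (j : Fin (d + 1)) (S) :
    (pairEmbedding M d b).cfg ⟨setChoice b v j, S⟩ = (pairEmbedding M d b).cfg ⟨v, S⟩ := by
  simp [Embedding.cfg, pairEmbedding]

theorem cfg_congr {b : Bool} {s s' : State (Alphabet (PairAlphabet M)) (Regs × PairState M d)}
    (h : s.var.2 = s'.var.2) (h' : ∀ k, s.stk (.inr k) = s'.stk (.inr k)) :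
    (pairEmbedding M d b).cfg s = (pairEmbedding M d b).cfg s' := by
  simp [Embedding.cfg, pairEmbedding, h, h']

open Classical in
/-- Execute the selected alternative of machine `b`. -/
noncomputable def Prog.execute (b : Bool) :
    Prog (Alphabet (PairAlphabet M)) (Regs × PairState M d) :=
  .select (fun v => ((v.2 b).1.1, (v.2 b).2)) (fun i => match i.1 with
    | none => .skip
    | some l => match ((M b).m l)[i.2.1]? with
      | none => .load (require false)
      | some q => .seq ((pairEmbedding M d b).translate q) (.load fun v => setChoice b v 0))
    Finset.univ.toList

/-- Process the bit read last, see `NTM.Accepts`. -/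
noncomputable def Prog.consume (b : Bool) :
    Prog (Alphabet (PairAlphabet M)) (Regs × PairState M d) :=
  .ite (fun v => (v.2 b).1.1.isNone) (.load fun v => require (v.1.sym == some false) v) <|
  .ite (fun v => v.1.sym == some true)
    (.load fun v => if h : (v.2 b).2.1 < d then setChoice b v ⟨(v.2 b).2.1 + 1, by omega⟩
      else require false v)
    (.execute b)

open Classical in
/-- Check whether `inp` contains a code of an accepting path of machine `b` with as many bits as
there are symbols on `us`. -/
noncomputable def Prog.checkWitness (b : Bool) :
    Prog (Alphabet (PairAlphabet M)) (Regs × PairState M d) :=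
  .seq (.forTape .inp (.seq (.pop (.inl .us) fun v o => require o.isSome v)
    (.ite (fun v => v.1.ok) (.consume b) .skip))) <|
  .seq (.pop (.inl .us) fun v o => require o.isNone v)
    (.load fun v => require ((v.2 b).1.1.isNone && decide ((v.2 b).1.2 ∈ (M b).accept)) v)

/-- The check succeeds from here on with bits `l`. -/
def WillAccept (b : Bool) (l : List Bool) (s : State (Alphabet (PairAlphabet M))
    (Regs × PairState M d)) : Prop :=
  s.var.1.ok = true ∧ (M b).Accepts d ((pairEmbedding M d b).cfg s) (s.var.2 b).2 l

theorem willAccept_iff {b : Bool} {l : List Bool}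
    {s s' : State (Alphabet (PairAlphabet M)) (Regs × PairState M d)}
    (h : s.var.2 = s'.var.2) (h' : ∀ k, s.stk (.inr k) = s'.stk (.inr k)) :
    WillAccept b l s ↔ s.var.1.ok = true ∧
      (M b).Accepts d ((pairEmbedding M d b).cfg s') (s'.var.2 b).2 l :=
  and_congr_right fun _ => iff_of_eq (congrArg₂ (fun c (j : Fin (d + 1)) => (M b).Accepts d c j l)
    (cfg_congr h h') (by rw [h]))

theorem runs_execute (b : Bool) (l : List Bool)
    (s : State (Alphabet (PairAlphabet M)) (Regs × PairState M d))
    (hl : ((pairEmbedding M d b).cfg s).l ≠ none) :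
    Runs (.execute b) s 0 fun s' => (∀ a, s'.stk (.inl a) = s.stk (.inl a)) ∧
      (WillAccept b l s' ↔ s.var.1.ok = true ∧ ∃ c',
        (M b).step ((pairEmbedding M d b).cfg s) (s.var.2 b).2 = some c' ∧
        (M b).Accepts d c' 0 l) := by
  classical
  refine Runs.select (by simp) ?_
  have hstep : (M b).step ((pairEmbedding M d b).cfg s) (s.var.2 b).2 =
    (s.var.2 b).1.1.bind fun l => ((M b).m l)[((s.var.2 b).2 : ℕ)]?.map fun q =>
      TM2.stepAux q ((pairEmbedding M d b).cfg s).var ((pairEmbedding M d b).cfg s).stk := rfl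
  rw [hstep]
  have hl' : (s.var.2 b).1.1 ≠ none := hl
  obtain ⟨l', hl'⟩ := Option.ne_none_iff_exists'.1 hl'
  simp only [hl', Option.bind_some]
  cases hq : ((M b).m l')[((s.var.2 b).2 : ℕ)]? with
  | none =>
    exact Runs.load ⟨fun _ => rfl, fun h => by simp [WillAccept] at h,
      fun ⟨_, _, h, _⟩ => by cases h⟩
  | some q =>
    refine Runs.seq_zero (((pairEmbedding M d b).runs_translate q s).mono le_rfl ?_)
    rintro s' ⟨h₁, h₂, h₃⟩
    refine Runs.load ⟨fun a => h₃ _ fun k' hk' => (by cases hk'), ?_⟩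
    have hok : s'.var.1 = s.var.1 := by rw [h₂]; rfl
    simp only [WillAccept, cfg_setChoice, hok, Function.update_self, Fin.val_zero]
    rw [show (⟨s'.var, s'.stk⟩ : State _ _) = s' from rfl, h₁]
    exact ⟨fun ⟨h, h'⟩ => ⟨h, _, rfl, h'⟩, fun ⟨h, c', h', h''⟩ => ⟨h, by cases h'; exact h''⟩⟩

/-- Acceptance of the remaining bits is invariant; the three branches match the three clauses of
`NTM.Accepts`. -/
theorem runs_consume (b a : Bool) (l : List Bool)
    (s : State (Alphabet (PairAlphabet M)) (Regs × PairState M d))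
    (ha : s.var.1.sym = some a) :
    Runs (.consume b) s 0 fun s' => (∀ a, s'.stk (.inl a) = s.stk (.inl a)) ∧
      (WillAccept b l s' ↔ WillAccept b (a :: l) s) := by
  have hl : ((pairEmbedding M d b).cfg s).l = (s.var.2 b).1.1 := rfl
  refine Runs.ite (fun h => ?_) (fun h => Runs.ite (fun h' => ?_) fun h' => ?_)
  · refine Runs.load ⟨fun _ => rfl, ?_⟩
    have hn : (s.var.2 b).1.1 = none := by simpa using h
    change (s.var.1.ok && (s.var.1.sym == some false)) = true ∧
      (M b).Accepts d ((pairEmbedding M d b).cfg s) (s.var.2 b).2 l ↔ _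
    simp [WillAccept, NTM.Accepts, hl, hn, ha, and_assoc]
  · have hn : (s.var.2 b).1.1 ≠ none := fun h₀ => by simp [h₀] at h
    obtain rfl : a = true := by simpa [ha] using h'
    refine Runs.load ⟨fun _ => rfl, ?_⟩
    split_ifs with hj
    · simp [WillAccept, NTM.Accepts, cfg_setChoice, hl, hn, hj]
    · simp [WillAccept, NTM.Accepts, hl, hn, hj]
  · have hn : (s.var.2 b).1.1 ≠ none := fun h₀ => by simp [h₀] at h
    obtain rfl : a = false := by simpa [ha] using h'
    refine (runs_execute b l s hn).mono le_rfl fun s' hs' => ⟨hs'.1, hs'.2.trans ?_⟩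
    simp [WillAccept, NTM.Accepts, hl, hn]

theorem runs_checkWitness (b : Bool)
    (s : State (Alphabet (PairAlphabet M)) (Regs × PairState M d)) :
    Runs (.checkWitness b) s ((s.stk (.inl .inp)).length + 1) fun s' =>
      s'.stk (.inl .xs) = s.stk (.inl .xs) ∧ (s'.var.1.ok = true ↔
        (s.stk (.inl .us)).length = (s.stk (.inl .inp)).length ∧
        WillAccept b (s.stk (.inl .inp)) s) := by
  classical
  -- `P` is the truth value to be decided. Throughout the loop the remaining bits, matched with the
  -- remaining symbols on `us`, decide the same `P`.
  generalize hP : ((s.stk (.inl .us)).length = (s.stk (.inl .inp)).length ∧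
        WillAccept b (s.stk (.inl .inp)) s) = P
  generalize hx : s.stk (.inl .xs) = x
  refine Runs.le (Runs.seq (T := (s.stk (.inl .inp)).length + 1) (T' := 0) ?_) le_rfl
  refine Runs.forTape (T := 0) (l := s.stk (.inl .inp))
    (fun l s => s.stk (.inl .inp) = l ∧ s.stk (.inl .xs) = x ∧
      ((s.stk (.inl .us)).length = l.length ∧ WillAccept b l s ↔ P))
    ⟨rfl, hx, by rw [hP]⟩ (by simp) (fun l s h => h.1) ?_ ?_
  · rintro a l s ⟨h₁, h₂, h₃⟩
    rw [← h₃]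
    refine Runs.seq_zero (Runs.pop (Runs.ite (fun h => ?_) fun h => Runs.skip ?_))
    · refine (runs_consume b a l _ rfl).mono le_rfl ?_
      rintro s' ⟨h₄, h₅⟩
      refine ⟨by simp [h₄], by simp [h₄, h₂], ?_⟩
      rw [h₅, h₄]
      have hs : s.var.1.ok = true ∧ s.stk (.inl .us) ≠ [] := by
        simp only [Bool.and_eq_true] at h
        refine ⟨h.1, fun h' => ?_⟩
        simp [h'] at h
      obtain ⟨c, u, hu⟩ := List.exists_cons_of_ne_nil hs.2
      refine (and_congr Iff.rfl (willAccept_iff (s' := s) ?_ ?_)).trans ?_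
      · rfl
      · simp
      · simp [hu, hs.1, WillAccept]
    · refine ⟨by simp, by simp [h₂], ?_⟩
      constructor
      · rintro ⟨-, hok, -⟩
        exact absurd (h.symm.trans hok) (by simp)
      · rintro ⟨hlen, hok, -⟩
        obtain ⟨c, u, hu⟩ := List.exists_cons_of_length_eq_add_one hlen
        simp [hok, hu] at h
  · rintro s ⟨h₁, h₂, h₃⟩
    refine Runs.seq_zero (Runs.pop (Runs.load ⟨by simp [h₂], ?_⟩))
    rw [← h₃]
    change ((s.var.1.ok && (s.stk (.inl .us)).head?.isNone) &&
      ((s.var.2 b).1.1.isNone && decide ((s.var.2 b).1.2 ∈ (M b).accept))) = true ↔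
      _ ∧ s.var.1.ok = true ∧ (s.var.2 b).1.1 = none ∧ (s.var.2 b).1.2 ∈ (M b).accept
    cases s.stk (.inl .us) <;> simp

/-- Split the input `prefixCode x z`: put `x` in reverse on `xs`, and leave `z`. -/
def Prog.splitCode {K' : Type} {Γ' : K' → Type} {τ : Type} : Prog (Alphabet Γ') (Regs × τ) :=
  .loop (.read .inp) (fun v => v.1.sym == some true) (.seq (.read .inp) (.write .xs))

/-- Each round removes a pair `1a`. The length bound in the case of failure keeps the later clearing
of `xs` cheap. -/
theorem runs_splitCode {K' : Type} [DecidableEq K'] {Γ' : K' → Type} {τ : Type} {ok b : Bool}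
    {t : τ} {u v w : List Bool} {S : ∀ k, List (Γ' k)} : ∀ (y x : List Bool) (o : Option Bool),
    Runs .splitCode (memory ok o b t y x u v w S) (y.length + 1) fun s =>
      (∃ x' z, y = prefixCode x' z ∧ s = memory ok (some false) b t z (x'.reverse ++ x) u v w S) ∨
      ((¬∃ x' z, y = prefixCode x' z) ∧ s.var.1.sym = none ∧
        (s.stk (.inl .xs)).length ≤ y.length + x.length)
  | [], x, o => by
    refine Runs.le (Runs.loopExit (T := 0) (Runs.pop ⟨rfl, Or.inr ⟨?_, rfl, by simp⟩⟩)) (by simp)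
    rintro ⟨_ | _, z, h⟩ <;> simp [prefixCode] at h
  | [true], x, o => by
    refine Runs.le (Runs.loopNext (T := 0) (T' := 0) (T'' := 1) (Runs.pop ⟨rfl,
      Runs.seq_zero (Runs.pop (Runs.push (Runs.loopExit (T := 0)
        (Runs.pop ⟨by simp, Or.inr ⟨?_, by simp, by simp⟩⟩))))⟩)) (by simp)
    rintro ⟨_ | _, z, h⟩ <;> simp [prefixCode] at h
  | false :: z, x, o => by
    refine Runs.le (Runs.loopExit (T := 0) (Runs.pop ⟨rfl, Or.inl ⟨[], z, rfl, ?_⟩⟩)) (by simp)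
    simp
  | true :: a :: y, x, o => by
    refine Runs.le (Runs.loopNext (T := 0) (T' := 0) (T'' := y.length + 1) (Runs.pop ⟨rfl,
      Runs.seq_zero (Runs.pop (Runs.push ?_))⟩)) (by simp; omega)
    simp only [contents_inp, List.head?_cons, List.tail_cons, update_contents_inp, contents_xs,
      Option.getD_some, update_contents_xs]
    refine (runs_splitCode y (a :: x) (some a)).mono le_rfl ?_
    rintro s (⟨x', z, rfl, rfl⟩ | ⟨h₁, h₂, h₃⟩)
    · exact Or.inl ⟨a :: x', z, rfl, by simp⟩
    · refine Or.inr ⟨?_, h₂, h₃.trans (by simp; omega)⟩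
      rintro ⟨_ | ⟨a', x'⟩, z, h⟩
      · simp [prefixCode] at h
      · simp only [prefixCode, List.cons.injEq, true_and] at h
        exact h₁ ⟨x', z, h.2⟩

/-- Split the input `prefixCode x (b :: z)`: put `x` in reverse on top of a final bit on `xs`,
store the bit `b` and leave `z`. -/
def Prog.parse {K' : Type} {Γ' : K' → Type} {τ : Type} : Prog (Alphabet Γ') (Regs × τ) :=
  .seq (.writeBit .xs true) <| .seq .splitCode <|
  .ite (fun v => v.1.sym == some false)
    (.pop (.inl .inp) fun v o => (⟨v.1.ok && o.isSome, v.1.sym, o.getD false⟩, v.2))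
    (.load (require false))

theorem runs_parse {K' : Type} [DecidableEq K'] {Γ' : K' → Type} {τ : Type} {b : Bool}
    {t : τ} {y u v w : List Bool} {S : ∀ k, List (Γ' k)} {o : Option Bool} :
    Runs .parse (memory true o b t y [] u v w S) (y.length + 1) fun s =>
      (∃ x b z, y = prefixCode x (b :: z) ∧
        s = memory true (some false) b t z (x.reverse ++ [true]) u v w S) ∨
      ((¬∃ x b z, y = prefixCode x (b :: z)) ∧ s.var.1.ok = false ∧
        (s.stk (.inl .xs)).length ≤ y.length + 1) := by
  refine Runs.seq_zero (Runs.push ?_)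
  simp only [contents_xs, update_contents_xs]
  refine Runs.le (Runs.seq (T' := 0) ((runs_splitCode _ _ _).mono le_rfl ?_)) le_rfl
  rintro s (⟨x', z, rfl, rfl⟩ | ⟨h₁, h₂, h₃⟩)
  · refine Runs.ite (fun _ => Runs.pop ?_) (fun h => by simp at h)
    rcases z with _ | ⟨b, z⟩
    · refine Or.inr ⟨?_, by simp, by simp [length_prefixCode]; omega⟩
      rintro ⟨x, b, z, h⟩
      cases (prefixCode_inj h).2
    · exact Or.inl ⟨x', b, z, rfl, by simp⟩
  · refine Runs.ite (fun h => by simp [h₂] at h) (fun _ => Runs.load (Or.inr ⟨?_, by simp, h₃⟩))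
    rintro ⟨x, b, z, h⟩
    exact h₁ ⟨x, b :: z, h⟩

/-- Copy the string whose reverse lies on top of a final bit on `xs` to the input stack of the
machine `b`. -/
def Prog.copyInput (b : Bool) : Prog (Alphabet (PairAlphabet M)) (Regs × PairState M d) :=
  .seq (.forTape .xs (.seq (.write .ys)
    (.push (.inr ⟨b, (M b).k₀⟩) fun v => (M b).inputAlphabet.symm (v.1.sym.getD false)))) <|
  -- The final bit of `xs` is copied last, lies on top of the input, and is dropped.
  .seq (.pop (.inr ⟨b, (M b).k₀⟩) fun v _ => v) (.forTape .ys (.write .xs))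

theorem runs_copyInput {b ok b' : Bool} {o : Option Bool} {t : PairState M d}
    {i x u v : List Bool} :
    Runs (.copyInput b) (memory ok o b' t i (x.reverse ++ [true]) [] u v fun _ => [])
      (2 * x.length + 4) fun s => ∃ o, s = memory ok o b' t i (x.reverse ++ [true]) [] u v
        (Function.update (fun _ => []) ⟨b, (M b).k₀⟩ (x.map (M b).inputAlphabet.symm)) := by
  refine Runs.le (Runs.seq (T := x.length + 2) (T' := x.length + 2) ?_) (by omega)
  refine Runs.forTape (T := 0) (l := x.reverse ++ [true])
    (fun l s => ∃ o y, s = memory ok o b' t i l y u v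
        (Function.update (fun _ => []) ⟨b, (M b).k₀⟩ (y.map (M b).inputAlphabet.symm)) ∧
        l.reverse ++ y = true :: x)
    ⟨o, [], by simp, by simp⟩ (by simp) ?_ ?_ ?_
  · rintro l s ⟨o, y, rfl, -⟩; rfl
  · rintro a l s ⟨o, y, rfl, hy⟩
    exact Runs.seq_zero (Runs.push (Runs.push ⟨some a, a :: y, by simp, by simpa using hy⟩))
  · rintro s ⟨o, y, rfl, hy⟩
    simp only [List.reverse_nil, List.nil_append] at hy
    subst hy
    refine Runs.seq_zero (Runs.pop ?_)
    simp only [contents_inr, update_contents_inr, Function.update_self, List.map_cons,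
      List.tail_cons, Function.update_idem]
    refine Runs.forTape (T := 0) (l := true :: x)
      (fun l s => ∃ o y, s = memory ok o b' t i y l u v
        (Function.update (fun _ => []) ⟨b, (M b).k₀⟩ (x.map (M b).inputAlphabet.symm)) ∧
        l.reverse ++ y = x.reverse ++ [true])
      ⟨_, [], rfl, by simp⟩ (by simp) ?_ ?_ ?_
    · rintro l s ⟨o, y, rfl, -⟩; rfl
    · rintro a l s ⟨o, y, rfl, hy⟩
      exact Runs.push ⟨some a, a :: y, by simp, by simpa using hy⟩
    · rintro s ⟨o, y, rfl, hy⟩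
      simp only [List.reverse_nil, List.nil_append] at hy
      subst hy
      exact ⟨_, rfl⟩

end Ranker

/-! ### The ranking function of the witness set -/

section Ranker

variable (M : Bool → NTM) (d : ℕ)

/-- The codes of `x`, a bit `b`, and a witness of the prescribed length for `x` and machine `b`. -/
def WitnessSet (c k : ℕ) : Set (List Bool) :=
  {y | ∃ x b z, y = prefixCode x (b :: z) ∧ z.length = c * (x.length + 1) ^ k ∧
    (M b).IsWitness d x z}

/-- The initial state of both machines. -/
abbrev startState : PairState M d := fun b => ((some (M b).main, (M b).initialState), 0)

variable {M d}

theorem cfg_copyInput (b ok b' : Bool) (o : Option Bool) (i x y u v : List Bool) :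
    (pairEmbedding M d b).cfg (memory ok o b'
      (startState M d) i y [] u v
      (Function.update (fun _ => []) ⟨b, (M b).k₀⟩ (x.map (M b).inputAlphabet.symm))) =
      (M b).init x :=
  congrArg (TM2.Cfg.mk (some (M b).main) (M b).initialState)
    (Function.update_comp_eq_of_injective' (fun _ => [] : ∀ p, List (PairAlphabet M p))
      (sigma_mk_injective (i := b)) (M b).k₀ (x.map (M b).inputAlphabet.symm))

/-- Copy the input and check the witness. -/
noncomputable def Prog.verify (b : Bool) :
    Prog (Alphabet (PairAlphabet M)) (Regs × PairState M d) :=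
  .seq (.copyInput b) (.checkWitness b)

theorem runs_verify {b : Bool} {o : Option Bool} {b' : Bool} {x z : List Bool} {Z : ℕ} :
    Runs (.verify b) (memory true o b' (startState M d)
        z (x.reverse ++ [true]) [] (List.replicate Z true) [] fun _ => [])
      (2 * x.length + 4 + (z.length + 1)) fun s => s.stk (.inl .xs) = x.reverse ++ [true] ∧
        (s.var.1.ok = true ↔ z.length = Z ∧ (M b).IsWitness d x z) := by
  refine Runs.seq (runs_copyInput.mono le_rfl ?_)
  rintro s ⟨o, rfl⟩
  refine (runs_checkWitness b _).mono le_rfl ?_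
  rintro s ⟨h₁, h₂⟩
  refine ⟨h₁, h₂.trans ?_⟩
  have hw : ∀ i y u v, WillAccept (d := d) b z (memory true o b'
      (startState M d) i y [] u v
      (Function.update (fun _ => []) ⟨b, (M b).k₀⟩ (x.map (M b).inputAlphabet.symm))) ↔
      (M b).IsWitness d x z := by
    intro i y u v
    refine (and_iff_right rfl).trans (iff_of_eq ?_)
    exact congrArg (fun c => (M b).Accepts d c 0 z) (cfg_copyInput b true b' o i x y u v)
  refine (and_congr Iff.rfl (hw _ _ _ _)).trans ?_
  simp [eq_comm]

/-- The program that computes ranks in `WitnessSet M d c k`. -/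
noncomputable def Prog.ranker (c k : ℕ) :
    Prog (Alphabet (PairAlphabet M)) (Regs × PairState M d) :=
  .seq .parse <|
  .seq (.ite (fun v => v.1.ok) (.seq (.clock c k)
    (.ite (fun v => v.1.bit) (.verify true) (.verify false))) .skip) <|
  -- By `encodeNat_index`, `xs` already contains the numeral of `index x`; only the leading bit of
  -- the output is missing.
  .ite (fun v => v.1.ok) (.writeBit .xs true) (.seq (.forTape .xs .skip) (.writeBit .xs false))

theorem runs_ranker (c k : ℕ) (y : List Bool) :
    Runs (.ranker c k) (memory true none true
      (startState M d) y [] [] [] [] fun _ => [])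
      (y.length + 1 + ((k * (c * y.length ^ k * (3 * y.length + 3) + 2) + (2 * y.length + 4 +
        (y.length + 1))) + (y.length + 2)))
      fun s => (∃ x b z, y = prefixCode x (b :: z) ∧ z.length = c * (x.length + 1) ^ k ∧
          (M b).IsWitness d x z ∧ s.stk (.inl .xs) = true :: encodeNat (index x)) ∨
        (y ∉ WitnessSet M d c k ∧ s.stk (.inl .xs) = [false]) := by
  refine Runs.seq (runs_parse.mono le_rfl fun s hs => Runs.seq (Runs.mono
    (Q := fun s => (s.stk (.inl .xs)).length ≤ y.length + 1 ∧
      (s.var.1.ok = true → ∃ x b z, y = prefixCode x (b :: z) ∧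
        z.length = c * (x.length + 1) ^ k ∧ (M b).IsWitness d x z ∧
        s.stk (.inl .xs) = x.reverse ++ [true]) ∧
      (s.var.1.ok = false → y ∉ WitnessSet M d c k)) ?_ le_rfl ?_))
  · rcases hs with ⟨x, b, z, rfl, rfl⟩ | ⟨h₁, h₂, h₃⟩
    · refine Runs.ite (fun _ => ?_) (fun h => by simp at h)
      have hlen : (prefixCode x (b :: z)).length = 2 * x.length + 1 + (z.length + 1) := by
        simp [length_prefixCode]
      have hc := runs_clock (K' := Σ b, (M b).K) (Γ' := PairAlphabet M) (c := c) (k := k)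
        (ok := true) (b := b) (o := some false)
        (t := (startState M d)) (i := z)
        (x := x.reverse ++ [true]) (S := fun _ => []) (by simp)
      simp only [List.length_append, List.length_reverse, List.length_singleton] at hc
      have hx : x.length + 1 ≤ (prefixCode x (b :: z)).length := by omega
      refine Runs.seq (hc.mono (by gcongr) ?_)
      rintro s ⟨o, rfl⟩
      have key : ∀ b', b' = b → Runs (.verify b') (memory true o b
          (startState M d) z (x.reverse ++ [true]) []
          (List.replicate (c * (x.length + 1) ^ k) true) [] fun _ => [])
          (2 * (prefixCode x (b :: z)).length + 4 + ((prefixCode x (b :: z)).length + 1)) fun s =>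
          (s.stk (.inl .xs)).length ≤ (prefixCode x (b :: z)).length + 1 ∧
          (s.var.1.ok = true → ∃ x' b' z', prefixCode x (b :: z) = prefixCode x' (b' :: z') ∧
            z'.length = c * (x'.length + 1) ^ k ∧ (M b').IsWitness d x' z' ∧
            s.stk (.inl .xs) = x'.reverse ++ [true]) ∧
          (s.var.1.ok = false → prefixCode x (b :: z) ∉ WitnessSet M d c k) := by
        rintro _ rfl
        refine runs_verify.mono (by omega) ?_
        rintro s ⟨h₁, h₂⟩
        refine ⟨?_, fun h => ⟨x, _, z, rfl, (h₂.1 h).1, (h₂.1 h).2, h₁⟩, fun h => ?_⟩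
        · rw [h₁]
          simp
          omega
        · rintro ⟨x', b', z', h', h''⟩
          obtain ⟨rfl, e⟩ := prefixCode_inj h'
          obtain ⟨rfl, rfl⟩ := List.cons.inj e
          rw [h₂.2 h''] at h
          cases h
      exact Runs.ite (fun h => key true h.symm) (fun h => key false h.symm)
    · refine Runs.ite (fun h => by simp [h₂] at h) (fun _ => Runs.skip ⟨h₃, ?_, fun _ => ?_⟩)
      · intro h
        simp [h₂] at h
      · rintro ⟨x, b, z, h, -⟩
        exact h₁ ⟨x, b, z, h⟩
  · rintro s ⟨h₁, h₂, h₃⟩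
    refine Runs.ite (fun h => ?_) (fun h => ?_)
    · obtain ⟨x, b, z, hy, hz, hw, hx⟩ := h₂ h
      refine Runs.push (Or.inl ⟨x, b, z, hy, hz, hw, ?_⟩)
      simp [hx, encodeNat_index]
    · refine Runs.le (Runs.seq (T := y.length + 2) (T' := 0) ?_) le_rfl
      refine Runs.forTape (T := 0) (l := s.stk (.inl .xs)) (fun l s => s.stk (.inl .xs) = l) rfl
        (by simpa using h₁) (fun _ _ h => h) (fun a l s h => Runs.skip (by simp)) ?_
      intro s hs
      exact Runs.push (Or.inr ⟨h₃ h, by simp [hs]⟩)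

-- The code determines `x`, and the value depends on `x` alone, so the choice in `f` is harmless.
-- This value is the rank once every `x` has exactly one witness.
open Polynomial in
theorem exists_ranker (c k : ℕ) : ∃ f ∈ FP,
    (∀ x b z, z.length = c * (x.length + 1) ^ k → (M b).IsWitness d x z →
      f (prefixCode x (b :: z)) = true :: encodeNat (index x)) ∧
    ∀ y ∉ WitnessSet M d c k, f y = [false] := by
  classical
  let f : List Bool → List Bool := fun y =>
    if h : y ∈ WitnessSet M d c k then true :: encodeNat (index h.choose) else [false]
  have hf : ∀ x b z, z.length = c * (x.length + 1) ^ k → (M b).IsWitness d x z →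
      f (prefixCode x (b :: z)) = true :: encodeNat (index x) := by
    intro x b z hz hw
    have h : prefixCode x (b :: z) ∈ WitnessSet M d c k := ⟨x, b, z, rfl, hz, hw⟩
    obtain ⟨b', z', h', -⟩ := h.choose_spec
    simp only [f, dif_pos h]
    rw [← (prefixCode_inj h').1]
  refine ⟨f, ?_, hf, fun y hy => dif_neg hy⟩
  refine nonempty_polyTime_of_runs (Γ := Alphabet (PairAlphabet M)) (.inl .inp) (.inl .xs)
    (Equiv.refl Bool) (Equiv.refl Bool) (⟨true, none, true⟩, startState M d)
    (fun v b => (⟨b, v.1.sym, v.1.bit⟩, v.2)) (fun v => v.1.ok) (fun _ _ => rfl) (.ranker c k)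
    (X + 1 + ((C k * (C c * X ^ k * (3 * X + 3) + 2) + (2 * X + 4 + (X + 1))) + (X + 2)))
    fun y => ?_
  simp only [Equiv.refl_symm, Equiv.coe_refl, List.map_id]
  rw [ofInput_inl]
  refine (runs_ranker c k y).mono (by simp) ?_
  rintro s (⟨x, b, z, rfl, hz, hw, hs⟩ | ⟨hy, hs⟩)
  · rw [hs, hf x b z hz hw]
    rfl
  · rw [hs]
    exact (show f y = [false] from dif_neg hy).symm

end Ranker

/-! ### The inclusion of UP ∩ coUP in P -/

section Main

theorem exists_eval_le (P : Polynomial ℕ) : ∃ c k, ∀ n, P.eval n ≤ c * (n + 1) ^ k := by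
  induction P using Polynomial.induction_on' with
  | add P Q hP hQ =>
    obtain ⟨c, k, h⟩ := hP
    obtain ⟨c', k', h'⟩ := hQ
    refine ⟨c + c', k + k', fun n => ?_⟩
    rw [Polynomial.eval_add, add_mul]
    refine add_le_add ((h n).trans ?_) ((h' n).trans ?_) <;> gcongr <;> omega
  | monomial k c =>
    refine ⟨c, k, fun n => ?_⟩
    rw [Polynomial.eval_monomial]
    gcongr
    omega

theorem prefixCode_append (x z w : List Bool) :
    prefixCode x (z ++ w) = prefixCode x z ++ w := by
  induction x with
  | nil => rfl
  | cons a x ih => simp [prefixCode, ih]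

/-- Makes the query the greatest string of its length among those that continue the code of `x` by
0. -/
theorem eq_or_lex_replicate_true (z : List Bool) :
    z = List.replicate z.length true ∨ List.Lex (· < ·) z (List.replicate z.length true) := by
  induction z with
  | nil => exact Or.inl rfl
  | cons a z ih =>
    cases a
    · exact Or.inr (.rel (by decide))
    · rcases ih with h | h
      · exact Or.inl (congrArg _ h)
      · exact Or.inr (.cons h)

theorem mem_classP_of_mem (h : ClosedUnderCompl (SemistrongRankable FP)) {A : Set (List Bool)}
    (hA : A ∈ classUP) (hA' : Aᶜ ∈ classUP) : A ∈ classP := by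
  classical
  obtain ⟨N, ⟨P, hP⟩, hu, hN⟩ := hA
  obtain ⟨N', ⟨P', hP'⟩, hu', hN'⟩ := hA'
  obtain ⟨d₁, hd₁⟩ := N.exists_bound
  obtain ⟨d₂, hd₂⟩ := N'.exists_bound
  let M : Bool → NTM := fun b => bif b then N else N'
  let d := d₁ + d₂
  obtain ⟨c₀, k, hck⟩ := exists_eval_le ((P + P') * Polynomial.C (d + 1))
  -- A positive factor makes the block of ones in the query nonempty, so that the query ends in 1.
  let c := c₀ + 1
  have hc : ∀ n, (P.eval n + P'.eval n) * (d + 1) ≤ c * (n + 1) ^ k := fun n => by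
    refine le_trans ?_ ((hck n).trans (Nat.mul_le_mul_right _ (Nat.le_succ _)))
    simp
  have hM : ∀ b x, x ∈ (M b).language ↔ b = decide (x ∈ A) := by
    intro b x
    cases b
    · change x ∈ N'.language ↔ _
      simp [hN']
    · change x ∈ N.language ↔ _
      simp [hN]
  have hex : ∀ x, ∃ z : List Bool, z.length = c * (x.length + 1) ^ k ∧
      (M (decide (x ∈ A))).IsWitness d x z := by
    intro x
    have hx := (hM _ x).2 rfl
    have hc := hc x.length
    rw [add_mul] at hc
    revert hx
    cases decide (x ∈ A)
    · exact fun hx => NTM.exists_isWitness (d := d)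
        (fun c i c' h => (hd₂ c i c' h).trans (Nat.le_add_left _ _)) hP' hx (by omega)
    · exact fun hx => NTM.exists_isWitness (d := d)
        (fun c i c' h => (hd₁ c i c' h).trans (Nat.le_add_right _ _)) hP hx (by omega)
  choose z hz hw using hex
  have hMu : ∀ b, (M b).Unambiguous := fun b => by cases b; exacts [hu', hu]
  let Y : List Bool → List Bool := fun x => prefixCode x (decide (x ∈ A) :: z x)
  -- The bit is forced by the languages of the two machines, the witness by unambiguity and its
  -- length.
  have hB : WitnessSet M d c k = Set.range Y := by
    ext y
    constructor
    · rintro ⟨x, b, z', rfl, hz', hw'⟩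
      obtain rfl := (hM b x).1 hw'.mem_language
      exact ⟨x, by rw [(hMu _).eq_of_isWitness hw' (hw x) (hz'.trans (hz x).symm)]⟩
    · rintro ⟨x, rfl⟩
      exact ⟨x, _, _, rfl, hz x, hw x⟩
  have hmono : Monotone fun n : ℕ => c * (n + 1) ^ k + 1 := fun m n hmn => by
    dsimp only
    gcongr
  have hY : ∀ x x', List.Shortlex (· < ·) x x' → List.Shortlex (· < ·) (Y x) (Y x') :=
    fun x x' hx => shortlex_prefixCode hmono hx (by simp [hz]) (by simp [hz])
  have hrank : ∀ x, rank (Set.range Y) (Y x) = index x := fun x => by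
    rw [rank_range hY (x := x) (fun x' hx => (index_lt_index (hY _ _ (index_lt_index_iff.1 hx))).le)
      (fun x' hx => index_lt_index (hY _ _ (index_lt_index_iff.1 hx))), if_pos le_rfl]
  have hsr : Set.range Y ∈ SemistrongRankable FP := by
    obtain ⟨f, hf, hf₁, hf₂⟩ := exists_ranker (M := M) (d := d) c k
    refine ⟨f, hf, ?_, fun y hy => hf₂ y (hB ▸ hy)⟩
    rintro _ ⟨x, rfl⟩
    rw [hrank]
    exact hf₁ x _ _ (hz x) (hw x)
  obtain ⟨g, hg, hg₁, hg₂⟩ := h _ hsr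
  suffices hans : (fun x => decide (x ∈ A)) = fun x => answer g (c * (x.length + 1) ^ k) x by
    have := polyTime_answer hg c k
    rw [← hans] at this
    change Nonempty _
    convert this
  funext x
  have hZ : 0 < c * (x.length + 1) ^ k := by positivity
  simp only [answer]
  obtain ⟨q, hq⟩ : ∃ q, q = prefixCode x (false :: List.replicate (c * (x.length + 1) ^ k) true) :=
    ⟨_, rfl⟩
  rw [← hq]
  by_cases hqB : q ∈ Set.range Y
  -- A query in the witness set must be `Y x` itself, whose bit is then 0; here `g` reports "not in
  -- the set".
  · have hxA : x ∉ A := by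
      obtain ⟨x', hx'⟩ := hqB
      obtain ⟨rfl, h'⟩ := prefixCode_inj (hx'.trans hq)
      simpa using (List.cons.inj h').1
    simp [hg₂ q (not_not.2 hqB), encodeRank, hxA]
  -- The query counts itself, so its rank is positive and the numeral has a first digit to read.
  have hpos : 0 < rank (Set.range Y)ᶜ q :=
    (Set.ncard_pos ((finite_stringLE q).subset fun _ h => h.1)).2 ⟨q, Or.inl rfl, hqB⟩
  have hodd : (index q).bodd = true := by
    obtain ⟨m, hm⟩ := Nat.exists_eq_add_one_of_ne_zero hZ.ne'
    rw [hq, hm, List.replicate_succ', ← List.cons_append, prefixCode_append, index_append,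
      Nat.bodd_bit]
  have hlow : ∀ x', index x' < index x → index (Y x') ≤ index q := fun x' hx => by
    rw [hq]
    exact (index_lt_index (shortlex_prefixCode hmono (index_lt_index_iff.1 hx) (by simp [hz])
      (by simp))).le
  have hhigh : ∀ x', index x < index x' → index q < index (Y x') := fun x' hx => by
    rw [hq]
    exact index_lt_index (shortlex_prefixCode hmono (index_lt_index_iff.1 hx) (by simp)
      (by simp [hz]))
  have hr := rank_range hY hlow hhigh
  have hcompl := rank_add_rank_compl (Set.range Y) q
  -- The query separates the codes of `x` with bit 0 from those with bit 1.
  have hxq : index (Y x) ≤ index q ↔ x ∉ A := by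
    constructor
    · intro hle hxA
      refine hle.not_gt (index_lt_index ?_)
      rw [hq]
      refine .of_lex (by simp [Y, length_prefixCode, hz]) (lex_prefixCode_right x ?_)
      rw [decide_eq_true hxA]
      exact .rel (by decide)
    · intro hxA
      rw [← stringLE_iff, hq]
      simp only [Y, decide_eq_false hxA]
      rw [← hz x]
      rcases eq_or_lex_replicate_true (z x) with h' | h'
      · exact Or.inl (by rw [← h'])
      · exact Or.inr (.of_lex (by simp [length_prefixCode])
          (lex_prefixCode_right x (.cons h')))
  have hix := index_pos x
  rw [hg₁ q hqB, ← encodeNat_index, head?_encodeNat hix]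
  simp only [encodeRank, List.head?_cons, List.tail_cons, head?_encodeNat hpos]
  by_cases hxA : x ∈ A
  · rw [if_neg (by simpa [hxq] using hxA)] at hr
    -- Positions start at 1, so the truncated subtraction in `hr` is a genuine one.
    have : rank (Set.range Y)ᶜ q + index x = index q + 1 := by omega
    have := congrArg Nat.bodd this
    simp only [Nat.bodd_add, hodd] at this
    simp [hxA]
    revert this
    cases (rank (Set.range Y)ᶜ q).bodd <;> cases (index x).bodd <;> simp
  · rw [if_pos (hxq.2 hxA)] at hr
    have := congrArg Nat.bodd hcompl
    rw [hr, Nat.bodd_add, hodd] at this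
    simp [hxA]
    revert this
    cases (rank (Set.range Y)ᶜ q).bodd <;> cases (index x).bodd <;> simp

end Main

end RankUP

theorem mainTheorem3
    (h : RankUP.ClosedUnderCompl (RankUP.SemistrongRankable RankUP.FP)) :
    RankUP.classP = RankUP.classUP ∩ RankUP.classCoUP :=
  Set.Subset.antisymm (fun _ hA => RankUP.mem_classUP_of_mem_classP hA)
    fun _ hA => RankUP.mem_classP_of_mem h hA.1 hA.2
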